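/- Theorem. All rings are associative and need not be unital; a $*$-ring is a ring $A$ with an additive involution satisfying $a^{**}=a$ and $(ab)^*=b^*a^*$. Write $\mathbb N=\{1,2,\dots\}$. For $T,B\subseteq A$ put $|T|^2=\{t^*t:t\in T\}$, let $B_\Sigma$ be the additive subsemigroup generated by $|B|^2$, and let $B/\mathbb N=\{a\in A:\exists n\in\mathbb N\ (na\in B)\}$. For $a\in A$ define, in $[0,\infty]$ and with $\inf\emptyset=\infty$, $$\lceil a\rceil=\sup_{b\in A}\inf\{m/n: m,n\in\mathbb N,\ m\,bb^*-n\,bab^*\in A_\Sigma\},\qquad \|a\|=\sqrt{\max(\lceil aa^*\rceil,\lceil a^*a\rceil)}.$$ Put $A^1=\{a\in A:\|a\|\le1\}$, let $a\le b$ mean $\lceil a-b\rceil=0$, and let $B_+=\{a\in B:a\ge0\}$. Standing assumptions. $A$ is a $*$-ring such that, for all $a\in A$: $\lceil -a\rceil=0$ implies $\lceil a\rceil<\infty$ (Archimedean); $\lceil a\rceil=\lceil -a\rceil=0$ implies $a=0$ (infinitesimal-free); $aa^*=0$ implies $a=0$ (proper). Further, $S\subseteq A^1$ is closed under product and involution,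 and $E\subseteq S$ is closed under product and involution with $s^*Es\subseteq E$ for all $s\in S$, $|S|^2\subseteq E$, and every element of $|S|^2$ commuting with every element of $E$. Finally, $L$ is a commutative $*$-subring of $A$ which is a lattice with respect to $\le$, such that $|S|^2\subseteq L$, every $x\in L_+$ with $x\le s^*s$ for some $s\in S$ lies in $S$, and either $L_+=L_\Sigma/\mathbb N$, or $A$ is unital and every self-adjoint product of two elements of $A_+$ lies in $A_+$. For $a,b\in S$ write $a\sim b$ if $ab^*\in E$, and $a\precsim b$ if $a\sim b$ and $a=ab^*b$. For $T\subseteq S$ let $T^{\succsim}=\{s\in S:\exists t\in T\ (s\precsim t)\}$; write $a^{\succsim}=\{a\}^{\succsim}$ and $a^{\succsim\succsim}=(a^{\succsim})^{\succsim}$. A filter is a non-empty $U\subseteq S$ such that, for $a,b\in S$, one has $a,b\in U$ if and only if some $c\in U$ satisfies $c\precsim a$ and $c\precsim b$; an ultrafilter is a filter $U\ne S$ that is maximal among the filters different from $S$. Let $\mathcal U$ be the set of all ultrafilters (the Weyl groupoid), with the topology generated by the sets $\mathcal U_a=\{U\in\mathcal U:a\in U\}$, $a\in S$. For subsets $O,N$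 of a topological space, $O\Subset N$ means that every open cover of $N$ has a finite subfamily covering $O$. Let $a,b\in S$. 1. If some $c\in S$ satisfies $a^{\succsim\succsim}\subseteq c^{\succsim}$ (in particular, if $a^{\succsim}\subseteq c^{\succsim}$) and $c\precsim b$, then $\mathcal U_a\Subset\mathcal U_b$. 2. Conversely, suppose $\mathcal U_a\Subset\mathcal U_b$. (i) If $E$ is the unit ball of the $*$-subring $R$ of $A$ that it generates, i.e. $E=R\cap A^1$, then some $c\in S$ satisfies $a^{\succsim\succsim}\subseteq c^{\succsim\succsim}$ (hence $a^{\succsim\succsim}\subseteq c^{\succsim}$) and $c\precsim b$. (ii) If $a,b\in S^{\succsim}$ and $a\sim b$, then some $c\in S$ satisfies $a^{\succsim}\subseteq c^{\succsim}$ (hence $a^{\succsim\succsim}\subseteq c^{\succsim\succsim}$) and $c\precsim b$. -/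

import Mathlib

open scoped ENNReal

namespace WeylGroupoid

section Semigroup

variable {A : Type*} [NonUnitalRing A] [StarRing A]

/-- The `*`-squares `|T|² = {t* t : t ∈ T}`. -/
def starSquares (T : Set A) : Set A := {x | ∃ t ∈ T, x = star t * t}

/-- `(S, E)` is a Weyl `*`-semigroup (with the product and involution of `A`): `S` is a
`*`-semigroup and `E ⊆ S` is a `*`-normal `*`-subsemigroup such that every `*`-square of `S` lies
in `E` and commutes with all elements of `E`. -/
structure IsWeylStarSemigroup (S E : Set A) : Prop where
  mul_mem : ∀ a ∈ S, ∀ b ∈ S, a * b ∈ S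
  star_mem : ∀ a ∈ S, star a ∈ S
  subset : E ⊆ S
  mul_mem_E : ∀ e ∈ E, ∀ f ∈ E, e * f ∈ E
  star_mem_E : ∀ e ∈ E, star e ∈ E
  normal : ∀ a ∈ S, ∀ e ∈ E, star a * e * a ∈ E
  squares_mem : starSquares S ⊆ E
  squares_comm : ∀ p ∈ starSquares S, ∀ e ∈ E, p * e = e * p

/-- Compatibility `a ∼ b`: `a b* ∈ E`. -/
def Compat (E : Set A) (a b : A) : Prop := a * star b ∈ E

/-- Domination `a ≺ b`: `a = a b`. -/
def Dom (a b : A) : Prop := a = a * b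

/-- `*`-domination `a ≾ b`: `a ∼ b` and `a ≺ b* b`. -/
def StarDom (E : Set A) (a b : A) : Prop := Compat E a b ∧ Dom a (star b * b)

/-- The elements of `S` that are `*`-dominated by some element of `T`. -/
def lower (S E T : Set A) : Set A := {s | s ∈ S ∧ ∃ t ∈ T, StarDom E s t}

/-- A filter in `S`: a non-empty `U ⊆ S` such that, for `a, b ∈ S`,
`a, b ∈ U` iff some `c ∈ U` has `c ≾ a` and `c ≾ b`. -/
structure IsStarFilter (S E U : Set A) : Prop where
  subset : U ⊆ S
  nonempty : U.Nonempty
  mem_iff : ∀ a ∈ S, ∀ b ∈ S, (a ∈ U ∧ b ∈ U) ↔ ∃ c ∈ U, StarDom E c a ∧ StarDom E c b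

/-- An ultrafilter in `S`: a maximal proper filter. -/
structure IsStarUltrafilter (S E U : Set A) : Prop where
  isFilter : IsStarFilter S E U
  proper : U ≠ S
  maximal : ∀ V : Set A, IsStarFilter S E V → V ≠ S → U ⊆ V → V = U

/-- The set of ultrafilters in `S` (the underlying space of the Weyl groupoid). -/
def Ultrafilters (S E : Set A) : Type _ := {U : Set A // IsStarUltrafilter S E U}

/-- `𝓤_a`: the ultrafilters that contain `a`. -/
def basicOpen (S E : Set A) (a : A) : Set (Ultrafilters S E) := {U | a ∈ U.1}

/-- The topology of the Weyl groupoid, generated by the sets `𝓤_a` for `a ∈ S`. -/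
instance (S E : Set A) : TopologicalSpace (Ultrafilters S E) :=
  TopologicalSpace.generateFrom {W | ∃ a ∈ S, W = basicOpen S E a}

end Semigroup

/-- Compact containment: every open cover of `N` has a finite subcover of `O`. -/
def CompactlyContained {X : Type*} [TopologicalSpace X] (O N : Set X) : Prop :=
  ∀ C : Set (Set X), (∀ W ∈ C, IsOpen W) → N ⊆ ⋃₀ C → ∃ F ⊆ C, F.Finite ∧ O ⊆ ⋃₀ F

section Ring

variable {A : Type*} [NonUnitalRing A] [StarRing A]

/-- `B_Σ`: the additive subsemigroup generated by the `*`-squares of `B`. -/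
def sumSquares (B : Set A) : Set A := AddSubsemigroup.closure (starSquares B)

/-- `B/ℕ`: the elements of `A` having a positive integer multiple in `B`. -/
def fractions (B : Set A) : Set A := {a | ∃ n : ℕ, 0 < n ∧ n • a ∈ B}

/-- `⌈a⌉ = sup_{b ∈ A} inf {m/n : m b b* - n b a b* ∈ A_Σ}`, with `m, n` positive integers and
`inf ∅ = ∞`. -/
noncomputable def bracket (a : A) : ℝ≥0∞ :=
  ⨆ b : A, sInf {r : ℝ≥0∞ | ∃ m n : ℕ, 0 < m ∧ 0 < n ∧
    m • (b * star b) - n • (b * a * star b) ∈ sumSquares (Set.univ : Set A) ∧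
    r = (m : ℝ≥0∞) / (n : ℝ≥0∞)}

/-- `‖a‖ = √(⌈a a*⌉ ∨ ⌈a* a⌉)`. -/
noncomputable def ringNorm (a : A) : ℝ≥0∞ :=
  (bracket (a * star a) ⊔ bracket (star a * a)) ^ (1 / 2 : ℝ)

/-- `a ≤ b` in the `*`-ring: `⌈a - b⌉ = 0`. -/
def Le (a b : A) : Prop := bracket (a - b) = 0

/-- `B₊`: the positive elements of `B`. -/
def pos (B : Set A) : Set A := {a | a ∈ B ∧ Le 0 a}

variable (A) in
/-- The unit ball `A¹`. -/
def unitBall : Set A := {a | ringNorm a ≤ 1}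

variable (A) in
/-- `A` is Archimedean: `⌈-a⌉ = 0` implies `⌈a⌉ < ∞`. -/
def IsArchimedean : Prop := ∀ a : A, bracket (-a) = 0 → bracket a < ∞

variable (A) in
/-- `A` is infinitesimal-free: `⌈a⌉ = ⌈-a⌉ = 0` implies `a = 0`. -/
def IsInfinitesimalFree : Prop := ∀ a : A, bracket a = 0 → bracket (-a) = 0 → a = 0

variable (A) in
/-- `A` is proper: `a a* = 0` implies `a = 0`. -/
def IsProper : Prop := ∀ a : A, a * star a = 0 → a = 0

variable (A) in
/-- `A` has a two-sided multiplicative unit. -/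
def IsUnital : Prop := ∃ u : A, ∀ a : A, u * a = a ∧ a * u = a

/-- `L` is `S`-hereditary: it contains `|S|²`, and every positive element of `L` below some
element of `|S|²` lies in `S`. -/
def IsHereditary (S : Set A) (L : Set A) : Prop :=
  starSquares S ⊆ L ∧ ∀ x ∈ pos L, (∃ s ∈ starSquares S, Le x s) → x ∈ S

/-- `L` is a lattice with respect to (the restriction of) `≤`: any two elements of `L` have a
least upper bound and a greatest lower bound in `L`. -/
def IsLatticeIn (L : Set A) : Prop :=
  ∀ x ∈ L, ∀ y ∈ L,
    (∃ z ∈ L, Le x z ∧ Le y z ∧ ∀ w ∈ L, Le x w → Le y w → Le z w) ∧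
    (∃ z ∈ L, Le z x ∧ Le z y ∧ ∀ w ∈ L, Le w x → Le w y → Le w z)

/-- The standing assumptions on `(A, S, E, L)`. -/
structure StandingAssumption (S E : Set A) (L : NonUnitalSubring A) : Prop where
  weyl : IsWeylStarSemigroup S E
  archimedean : IsArchimedean A
  infinitesimalFree : IsInfinitesimalFree A
  proper : IsProper A
  subset_unitBall : S ⊆ unitBall A
  star_mem : ∀ x ∈ L, star x ∈ L
  comm : ∀ x ∈ L, ∀ y ∈ L, x * y = y * x
  hereditary : IsHereditary S (L : Set A)
  lattice : IsLatticeIn (L : Set A)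
  positivity : pos (L : Set A) = fractions (sumSquares (L : Set A)) ∨
    (IsUnital A ∧ ∀ p ∈ pos (Set.univ : Set A), ∀ q ∈ pos (Set.univ : Set A),
      star (p * q) = p * q → p * q ∈ pos (Set.univ : Set A))

/-- The (not necessarily unital) `*`-subring of `A` generated by `E`. -/
def starSubringGenerated (E : Set A) : Set A :=
  {x | ∀ R : NonUnitalSubring A, (∀ y ∈ R, star y ∈ R) → E ⊆ (R : Set A) → x ∈ R}

end Ring

end WeylGroupoid

/-! The commutative ring `L` behaves like a ring of real functions in which the squares `s* s`, `s ∈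
S`, take values in `[0, 1]`. Products of positive elements of `L` are positive and positive elements
are bounded multipliers, so disjoint elements have product zero (`mul_eq_zero_of_inf_eq_zero`).
Truncations such as `(2q - u)⁺` and `2q ⊓ u` then act as Urysohn functions: `c ≾ b` can be
interpolated indefinitely (`exists_chain`). Since `≾`-directed families without `0` extend to
ultrafilters (`exists_ultrafilter`), such chains produce the required points of `𝓤`.

Finite covers become algebra through `sqJoin F`: if `F` meets every ultrafilter containing `a`, then
`sqJoin F` is a right unit for each `d ≾ a` (`mul_sqJoin_eq_self_of_cover`). Points outside `𝓤_a`
are seen by annihilation: if `d ≾ e ≾ a`, `𝓤_a ⊆ 𝓤_b` and `b ∈ U`, `a ∉ U`, then `d w* w = 0` for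
some `w ∈ U` (`exists_mul_sq_eq_zero`).

For part 1, if a cover of `𝓤_b` had no finite subfamily covering `𝓤_a`, cutting finite joins out of
a chain between `c` and `b` would give an ultrafilter in `𝓤_b` missed by the cover. For part 2,
covering `𝓤_b` by elements `t ≾ t' ≾ b` yields joins `j`, `j'` with `j j' = j`, and `c` is `b j'²`
in (i) and `b j²` in (ii). Compatibility with `b j²` is immediate if `a ∼ b`; otherwise `d j² b*` is
a polynomial in elements of `E` lying in `S`, hence in `R ∩ A¹ = E`. -/

namespace WeylGroupoid

/-! ### The bracket: infinitesimals and order bounds -/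

section Bracket

variable {A : Type*} [NonUnitalRing A] [StarRing A]

theorem star_mul_self_mem_sumSquares {B : Set A} {b : A} (hb : b ∈ B) :
    star b * b ∈ sumSquares B :=
  AddSubsemigroup.subset_closure ⟨b, hb, rfl⟩

theorem mul_star_self_mem_sumSquares (b : A) : b * star b ∈ sumSquares (Set.univ : Set A) := by
  simpa using star_mul_self_mem_sumSquares (B := Set.univ) (b := star b) trivial

theorem zero_mem_sumSquares : (0 : A) ∈ sumSquares (Set.univ : Set A) := by
  simpa using star_mul_self_mem_sumSquares (B := Set.univ) (b := (0 : A)) trivial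

theorem add_mem_sumSquares {B : Set A} {x y : A} (hx : x ∈ sumSquares B)
    (hy : y ∈ sumSquares B) : x + y ∈ sumSquares B :=
  (AddSubsemigroup.closure (starSquares B)).add_mem hx hy

theorem nsmul_mem_sumSquares {x : A} (hx : x ∈ sumSquares (Set.univ : Set A)) (n : ℕ) :
    n • x ∈ sumSquares (Set.univ : Set A) := by
  induction n with
  | zero => simpa using zero_mem_sumSquares
  | succ n ih => rw [succ_nsmul]; exact add_mem_sumSquares ih hx

theorem star_eq_of_mem_sumSquares {B : Set A} {x : A} (hx : x ∈ sumSquares B) : star x = x := by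
  refine AddSubsemigroup.closure_induction (p := fun x _ => star x = x) ?_ ?_ hx
  · rintro x ⟨t, -, rfl⟩
    simp
  · intro x y _ _ h1 h2
    rw [star_add, h1, h2]

theorem exists_of_bracket_lt {a : A} {p k : ℕ} (hk : 0 < k)
    (h : bracket a < (p : ℝ≥0∞) / k) (b : A) :
    ∃ m n : ℕ, 0 < m ∧ 0 < n ∧
      m • (b * star b) - n • (b * a * star b) ∈ sumSquares (Set.univ : Set A) ∧
      m * k < p * n := by
  have h1 := lt_of_le_of_lt (le_iSup (fun b : A => sInf {r : ℝ≥0∞ | ∃ m n : ℕ, 0 < m ∧ 0 < n ∧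
    m • (b * star b) - n • (b * a * star b) ∈ sumSquares (Set.univ : Set A) ∧
    r = (m : ℝ≥0∞) / (n : ℝ≥0∞)}) b) h
  obtain ⟨r, ⟨m, n, hm, hn, hmem, rfl⟩, hr⟩ := sInf_lt_iff.1 h1
  refine ⟨m, n, hm, hn, hmem, ?_⟩
  have hn0 : (n : ℝ≥0∞) ≠ 0 := by exact_mod_cast hn.ne'
  have hk0 : (k : ℝ≥0∞) ≠ 0 := by exact_mod_cast hk.ne'
  rw [ENNReal.div_lt_iff (Or.inl hn0) (Or.inl (ENNReal.natCast_ne_top n)),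
    ENNReal.div_eq_inv_mul, mul_assoc, ← ENNReal.div_eq_inv_mul,
    ENNReal.lt_div_iff_mul_lt (Or.inl hk0) (Or.inl (ENNReal.natCast_ne_top k))] at hr
  exact_mod_cast hr

/-- Bounds `m / n ≤ K / k` for all `k` replace an ε-argument by integer arithmetic. `K` may depend
on `b`, because the bracket is a supremum of separate infima. -/
theorem bracket_eq_zero_of {a : A}
    (h : ∀ b : A, ∃ K : ℕ, ∀ k : ℕ, 0 < k → ∃ m n : ℕ, 0 < m ∧ 0 < n ∧
      m • (b * star b) - n • (b * a * star b) ∈ sumSquares (Set.univ : Set A) ∧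
      k * m ≤ K * n) : bracket a = 0 := by
  refine le_antisymm (iSup_le fun b => ?_) bot_le
  obtain ⟨K, hK⟩ := h b
  refine le_of_forall_gt fun ε hε => ?_
  have hKε : ε / (K + 1 : ℕ) ≠ 0 :=
    (ENNReal.div_pos hε.ne' (ENNReal.natCast_ne_top _)).ne'
  obtain ⟨k, hk⟩ := ENNReal.exists_inv_nat_lt hKε
  have hk0 : k ≠ 0 := by
    rintro rfl
    simp at hk
  obtain ⟨m, n, hm, hn, hmem, hle⟩ := hK k (Nat.pos_of_ne_zero hk0)
  refine lt_of_le_of_lt (sInf_le ⟨m, n, hm, hn, hmem, rfl⟩) ?_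
  have hn0 : (n : ℝ≥0∞) ≠ 0 := by exact_mod_cast hn.ne'
  have hkk : (k : ℝ≥0∞) ≠ 0 := by exact_mod_cast hk0
  have h1 : (m : ℝ≥0∞) / n ≤ (k : ℝ≥0∞)⁻¹ * (K + 1 : ℕ) := by
    rw [ENNReal.div_le_iff hn0 (ENNReal.natCast_ne_top n), mul_assoc, ← ENNReal.div_eq_inv_mul,
      ENNReal.le_div_iff_mul_le (Or.inl hkk) (Or.inl (ENNReal.natCast_ne_top k))]
    have : m * k ≤ (K + 1) * n := by nlinarith
    exact_mod_cast this
  refine lt_of_le_of_lt h1 ?_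
  rwa [ENNReal.lt_div_iff_mul_lt (Or.inl (by exact_mod_cast (Nat.succ_ne_zero K)))
    (Or.inl (ENNReal.natCast_ne_top _))] at hk

theorem exists_of_bracket_eq_zero {a : A} (h : bracket a = 0) (b : A) {k : ℕ} (hk : 0 < k) :
    ∃ m n : ℕ, 0 < m ∧ 0 < n ∧
      m • (b * star b) - n • (b * a * star b) ∈ sumSquares (Set.univ : Set A) ∧ m * k < n := by
  have h1 : bracket a < ((1 : ℕ) : ℝ≥0∞) / k := by
    rw [h]
    exact ENNReal.div_pos (by simp) (ENNReal.natCast_ne_top _)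
  simpa using exists_of_bracket_lt hk h1 b

theorem exists_of_bracket_le {a : A} {N : ℕ} (h : bracket a ≤ N) (b : A) {k : ℕ} (hk : 0 < k) :
    ∃ m n : ℕ, 0 < m ∧ 0 < n ∧
      m • (b * star b) - n • (b * a * star b) ∈ sumSquares (Set.univ : Set A) ∧
      m * k < (N * k + 1) * n := by
  refine exists_of_bracket_lt hk (lt_of_le_of_lt h ?_) b
  rw [ENNReal.lt_div_iff_mul_lt (Or.inl (by exact_mod_cast hk.ne'))
    (Or.inl (ENNReal.natCast_ne_top k))]
  exact_mod_cast Nat.lt_succ_self _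

theorem exists_of_bracket_lt_top {a : A} (h : bracket a < ∞) :
    ∃ K : ℕ, bracket a ≤ K := by
  obtain ⟨K, hK⟩ := ENNReal.exists_nat_gt h.ne
  exact ⟨K, hK.le⟩

theorem bracket_neg_star_mul_self (s : A) : bracket (-(star s * s)) = 0 := by
  refine bracket_eq_zero_of fun b => ⟨1, fun k hk => ⟨1, k, one_pos, hk, ?_, by simp⟩⟩
  have h1 : (1 : ℕ) • (b * star b) - k • (b * -(star s * s) * star b)
      = b * star b + k • ((b * star s) * star (b * star s)) := by
    simp [mul_assoc, mul_neg, sub_neg_eq_add]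
  rw [h1]
  exact add_mem_sumSquares (mul_star_self_mem_sumSquares b)
    (nsmul_mem_sumSquares (mul_star_self_mem_sumSquares _) k)

theorem bracket_zero : bracket (0 : A) = 0 := by
  simpa using bracket_neg_star_mul_self (0 : A)

theorem bracket_add_eq_zero {a c : A} (ha : bracket a = 0) (hc : bracket c = 0) :
    bracket (a + c) = 0 := by
  refine bracket_eq_zero_of fun b => ⟨2, fun k hk => ?_⟩
  obtain ⟨m, n, hm, hn, h1, h2⟩ := exists_of_bracket_eq_zero ha b hk
  obtain ⟨m', n', hm', hn', h1', h2'⟩ := exists_of_bracket_eq_zero hc b hk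
  refine ⟨n' * m + n * m', n * n', by positivity, by positivity, ?_, by nlinarith⟩
  have h3 := add_mem_sumSquares (nsmul_mem_sumSquares h1 n') (nsmul_mem_sumSquares h1' n)
  convert h3 using 1
  simp only [mul_add, add_mul, smul_sub, smul_add, add_smul, mul_smul]
  rw [smul_comm n n', smul_comm n n' (b * c * star b)]
  abel_nf

theorem bracket_eq_zero_of_nsmul {a : A} {n : ℕ} (hn : 0 < n) (h : bracket (n • a) = 0) :
    bracket a = 0 := by
  refine bracket_eq_zero_of fun b => ⟨1, fun k hk => ?_⟩
  obtain ⟨m, n', hm, hn', h1, h2⟩ := exists_of_bracket_eq_zero h b hk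
  refine ⟨m, n' * n, hm, by positivity, ?_, by nlinarith⟩
  convert h1 using 2
  rw [mul_smul_comm, smul_mul_assoc, mul_smul]

/-- Sums of squares are self-adjoint, so each `b (a - a*) b*` is torsion; hence `±(a - a*)` both
have bracket zero. -/
theorem star_eq_of_bracket_eq_zero (hA : IsInfinitesimalFree A) {a : A} (h : bracket a = 0) :
    star a = a := by
  have key : ∀ b : A, ∃ n : ℕ, 0 < n ∧ n • (b * (a - star a) * star b) = 0 := by
    intro b
    obtain ⟨m, n, hm, hn, h1, -⟩ := exists_of_bracket_eq_zero h b one_pos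
    refine ⟨n, hn, ?_⟩
    have h2 := star_eq_of_mem_sumSquares h1
    simp only [star_sub, star_nsmul, star_mul, star_star] at h2
    have h3 : n • (b * (star a * star b)) = n • (b * a * star b) := by
      simpa using h2
    rw [mul_sub, sub_mul, smul_sub, ← h3, mul_assoc b (star a), sub_self]
  have h1 : a - star a = 0 := by
    refine hA _ (bracket_eq_zero_of fun b => ⟨1, fun k hk => ?_⟩)
      (bracket_eq_zero_of fun b => ⟨1, fun k hk => ?_⟩)
    · obtain ⟨n, hn, h0⟩ := key b
      refine ⟨1, k * n, one_pos, by positivity, ?_, by nlinarith⟩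
      rw [mul_smul, h0]
      simpa using mul_star_self_mem_sumSquares b
    · obtain ⟨n, hn, h0⟩ := key b
      refine ⟨1, k * n, one_pos, by positivity, ?_, by nlinarith⟩
      rw [mul_smul, mul_neg, neg_mul, smul_neg, h0]
      simpa using mul_star_self_mem_sumSquares b
  exact (sub_eq_zero.1 h1).symm

/-- Testing `⌈x⌉` at `b c` gives the inequality up to an error `c c* / k`, which is negligible
because the Archimedean property bounds `c c*`. -/
theorem le_conjugate_of_bracket_le (hA : IsArchimedean A) {x : A} {N : ℕ} (hx : bracket x ≤ N)
    (c : A) : Le (c * x * star c) (N • (c * star c)) := by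
  have h0 : bracket (c * star c) < ∞ := by
    refine hA _ ?_
    simpa using bracket_neg_star_mul_self (star c)
  obtain ⟨K, hK⟩ := exists_of_bracket_lt_top h0
  refine bracket_eq_zero_of fun b => ⟨K + 1, fun k hk => ?_⟩
  obtain ⟨M, P, hM, hP, h1, h2⟩ := exists_of_bracket_le hK b one_pos
  obtain ⟨m, n, hm, hn, h3, h4⟩ := exists_of_bracket_le hx (b * c) hk
  refine ⟨n * M, k * (n * P), by positivity, by positivity, ?_, ?_⟩
  -- The slack `r + 1 = (N k + 1) n - m k` is filled with extra copies of the square `b c (b c)*`.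
  · obtain ⟨r, hr⟩ := Nat.exists_eq_add_of_lt h4
    have h5 := add_mem_sumSquares
      (nsmul_mem_sumSquares (add_mem_sumSquares (nsmul_mem_sumSquares h3 k)
        (nsmul_mem_sumSquares (mul_star_self_mem_sumSquares (b * c)) (r + 1))) P)
      (nsmul_mem_sumSquares h1 n)
    convert h5 using 1
    have e1 : b * (c * star c) * star b = b * c * star (b * c) := by simp [mul_assoc]
    have e2 : b * (c * x * star c - N • (c * star c)) * star b
        = b * c * x * star (b * c) - N • (b * c * star (b * c)) := by
      simp [mul_sub, sub_mul, mul_assoc, mul_smul_comm, smul_mul_assoc]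
    rw [e1, e2]
    generalize b * c * star (b * c) = y
    generalize b * c * x * star (b * c) = z
    generalize b * star b = w
    have hr' : ((N : ℤ) * k + 1) * n = m * k + r + 1 := by exact_mod_cast hr
    simp only [← natCast_zsmul]
    push_cast
    have : (r : ℤ) + 1 = (N * k + 1) * n - m * k := by linarith
    rw [this]
    module
  · nlinarith [Nat.zero_le (n * k * P)]

theorem eq_zero_of_forall_nsmul_le (hA : IsInfinitesimalFree A) {p u : A} {N : ℕ}
    (hu : bracket u ≤ N) (hp : Le 0 p) (h : ∀ k : ℕ, Le (k • p) u) : p = 0 := by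
  refine hA p (bracket_eq_zero_of fun b => ⟨N + 2, fun k hk => ?_⟩) (by simpa [Le] using hp)
  obtain ⟨M, P, hM, hP, h1, h2⟩ := exists_of_bracket_le hu b one_pos
  obtain ⟨m, n, hm, hn, h3, h4⟩ := exists_of_bracket_eq_zero (h k) b one_pos
  refine ⟨P * m + n * M, n * P * k, by positivity, by positivity, ?_, ?_⟩
  · have h5 := add_mem_sumSquares (nsmul_mem_sumSquares h3 P) (nsmul_mem_sumSquares h1 n)
    convert h5 using 1
    simp only [mul_sub, sub_mul, mul_smul_comm, smul_mul_assoc]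
    generalize b * p * star b = y
    generalize b * u * star b = z
    generalize b * star b = w
    simp only [← natCast_zsmul]
    push_cast
    module
  · have h6 : P * m ≤ P * n := by nlinarith
    have h7 : n * M ≤ n * ((N + 1) * P) := by nlinarith
    nlinarith [Nat.mul_le_mul_left k (Nat.add_le_add h6 h7)]

theorem bracket_le_one_of_mem_unitBall {s : A} (hs : s ∈ unitBall A) :
    bracket (star s * s) ≤ (1 : ℕ) := by
  have h1 : (bracket (s * star s) ⊔ bracket (star s * s)) ^ (1 / 2 : ℝ) ≤ 1 := hs
  have h2 : bracket (s * star s) ⊔ bracket (star s * s) ≤ 1 := by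
    by_contra hc
    exact absurd h1 (not_le.2 (ENNReal.one_lt_rpow (not_le.1 hc) (by norm_num)))
  simpa using le_sup_right.trans h2

end Bracket

end WeylGroupoid

namespace WeylGroupoid

/-! ### Urysohn-type truncations in lattice-ordered commutative rings -/

section LatticeRing

variable {R : Type*} [NonUnitalCommRing R] [Lattice R] [IsOrderedAddMonoid R]

theorem inf_add_eq_zero {x y z : R} (hx : 0 ≤ x) (hy : 0 ≤ y) (hz : 0 ≤ z) (hxy : x ⊓ y = 0)
    (hxz : x ⊓ z = 0) : x ⊓ (y + z) = 0 := by
  refine le_antisymm ?_ (le_inf hx (add_nonneg hy hz))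
  have h1 : x ⊓ (y + z) ≤ (x ⊓ y) + (x ⊓ z) := by
    rw [inf_add, add_inf, add_inf]
    refine le_inf (le_inf ?_ ?_) (le_inf ?_ ?_)
    · exact inf_le_left.trans (le_add_of_nonneg_left hx)
    · exact inf_le_left.trans (le_add_of_nonneg_right hz)
    · exact inf_le_left.trans (le_add_of_nonneg_left hy)
    · exact inf_le_right
  simpa [hxy, hxz] using h1

theorem inf_nsmul_eq_zero {x y : R} (hx : 0 ≤ x) (hy : 0 ≤ y) (hxy : x ⊓ y = 0) (n : ℕ) :
    x ⊓ (n • y) = 0 := by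
  induction n with
  | zero => simpa using hx
  | succ n ih => rw [succ_nsmul]; exact inf_add_eq_zero hx (nsmul_nonneg hy n) hy ih hxy

variable (hmul : ∀ x y : R, 0 ≤ x → 0 ≤ y → 0 ≤ x * y)
  (hbdd : ∀ x : R, 0 ≤ x → ∃ N : ℕ, ∀ y : R, 0 ≤ y → y * x ≤ N • y)

section

include hmul hbdd

/-- Boundedness gives `x y ≤ N y` and `x y ≤ M x`, and multiples of disjoint elements remain
disjoint. -/
theorem mul_eq_zero_of_inf_eq_zero {x y : R} (hx : 0 ≤ x) (hy : 0 ≤ y) (hxy : x ⊓ y = 0) :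
    x * y = 0 := by
  obtain ⟨N, hN⟩ := hbdd x hx
  obtain ⟨M, hM⟩ := hbdd y hy
  refine le_antisymm ?_ (hmul x y hx hy)
  have h1 := inf_nsmul_eq_zero hx hy hxy N
  rw [inf_comm] at h1
  have h2 := inf_nsmul_eq_zero (nsmul_nonneg hy N) hx h1 M
  rw [← h2]
  exact le_inf (by rw [mul_comm]; exact hN y hy) (hM x hx)

theorem posPart_mul_negPart (v : R) : v⁺ * v⁻ = 0 :=
  mul_eq_zero_of_inf_eq_zero hmul hbdd (posPart_nonneg v) (negPart_nonneg v)
    (posPart_inf_negPart_eq_zero v)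

/-- `x v⁻ = x v v⁻ = -x (v⁻)²` is both nonnegative and nonpositive. -/
theorem mul_posPart_eq_self {x v : R} (hx : 0 ≤ x) (hxv : x * v = x) : x * v⁺ = x := by
  have h0 := posPart_mul_negPart hmul hbdd v
  have h1 : x * v⁻ = -(x * (v⁻ * v⁻)) := by
    calc x * v⁻ = x * v * v⁻ := by rw [hxv]
      _ = x * (v⁺ - v⁻) * v⁻ := by rw [posPart_sub_negPart]
      _ = x * (v⁺ * v⁻) - x * (v⁻ * v⁻) := by rw [mul_assoc, sub_mul, mul_sub]
      _ = -(x * (v⁻ * v⁻)) := by rw [h0]; simp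
  have h2 : x * v⁻ = 0 := by
    refine le_antisymm ?_ (hmul _ _ hx (negPart_nonneg v))
    rw [h1, neg_nonpos]
    exact hmul _ _ hx (hmul _ _ (negPart_nonneg v) (negPart_nonneg v))
  have h3 : x * v = x * v⁺ - x * v⁻ := by rw [← mul_sub, posPart_sub_negPart]
  rw [h2, sub_zero, hxv] at h3
  exact h3.symm

end

/-- Multiplication by `u` fixes `y` and does not increase `y - x`, so it cannot decrease `x`. -/
theorem mul_eq_self_of_le {x y u : R} (hu1 : ∀ x : R, 0 ≤ x → x * u ≤ x) (hx : 0 ≤ x)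
    (hxy : x ≤ y) (hy : y * u = y) : x * u = x := by
  refine le_antisymm (hu1 x hx) ?_
  have h := hu1 (y - x) (sub_nonneg.2 hxy)
  rw [sub_mul, hy] at h
  exact (sub_le_sub_iff_left y).1 h

theorem sub_inf_eq_negPart (x u : R) : u - x ⊓ u = (x - u)⁻ := by
  rw [sub_eq_add_neg, neg_inf, add_sup, negPart_def, neg_sub, add_neg_cancel, sub_eq_add_neg]

include hmul in
theorem mul_eq_zero_of_le {x y z : R} (hx : 0 ≤ x) (hz : 0 ≤ z) (hxy : x ≤ y)
    (h : y * z = 0) : x * z = 0 := by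
  refine le_antisymm ?_ (hmul x z hx hz)
  have h1 := hmul (y - x) z (sub_nonneg.2 hxy) hz
  rw [sub_mul, h, zero_sub, neg_nonneg] at h1
  exact h1

include hmul hbdd

/-- With functions in mind, `u = 1` wherever `q ≠ 0`. Then `s = (2q - u)⁺` is `1` where `q = 1` and
lives on `q > 1/2`, where `t = 2q ⊓ u` is `1`. -/
theorem exists_interpolants {q u : R} (hq : 0 ≤ q) (hu : 0 ≤ u) (hqle : q ≤ u)
    (hu1 : ∀ x : R, 0 ≤ x → x * u ≤ x) (hqu : q * u = q) :
    ∃ s t : R, 0 ≤ s ∧ s ≤ u ∧ 0 ≤ t ∧ t ≤ u ∧ s * t = s ∧ s * u = s ∧ t * u = t ∧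
      ∀ x : R, 0 ≤ x → x * q = x → x * s = x := by
  have hq2 : (2 • q) * u = 2 • q := by rw [smul_mul_assoc, hqu]
  have h2q : (0 : R) ≤ 2 • q := nsmul_nonneg hq 2
  have hs0 : (0 : R) ≤ (2 • q - u)⁺ := posPart_nonneg _
  have ht0 : (0 : R) ≤ 2 • q ⊓ u := le_inf h2q hu
  have hsq : (2 • q - u)⁺ ≤ 2 • q := sup_le (sub_le_self _ hu) h2q
  have hsu := mul_eq_self_of_le hu1 hs0 hsq hq2
  refine ⟨(2 • q - u)⁺, 2 • q ⊓ u, hs0, sup_le ?_ hu, ht0, inf_le_right, ?_, hsu,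
    mul_eq_self_of_le hu1 ht0 inf_le_left hq2, fun x hx hxq => ?_⟩
  · rw [sub_le_iff_le_add, two_nsmul]
    exact add_le_add hqle hqle
  · have h1 := posPart_mul_negPart hmul hbdd (2 • q - u)
    rw [← sub_inf_eq_negPart, mul_sub, hsu, sub_eq_zero] at h1
    exact h1.symm
  · refine mul_posPart_eq_self hmul hbdd hx ?_
    have hxu : x * u = x := by
      calc x * u = x * q * u := by rw [hxq]
        _ = x := by rw [mul_assoc, hqu, hxq]
    rw [mul_sub, mul_smul_comm, hxq, hxu, two_nsmul, add_sub_cancel_right]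

/-- Some `k p` exceeds `u`; `s` is the excess truncated by `u`, and `q = k p ⊓ u` equals `u` there.
If `s` were zero, the excess would be disjoint from its own unit `u`, hence zero. -/
theorem exists_ne_zero_unit {p u : R} (hp : 0 ≤ p) (hu : 0 ≤ u)
    (hu1 : ∀ x : R, 0 ≤ x → x * u ≤ x) (hpu : p * u = p) (harch : ¬ ∀ k : ℕ, k • p ≤ u) :
    ∃ (k : ℕ) (s q : R), 0 ≤ s ∧ s ≤ u ∧ 0 ≤ q ∧ q ≤ u ∧ s ≤ k • p ∧ q ≤ k • p ∧ s ≠ 0 ∧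
      s * q = s ∧ q * u = q := by
  push Not at harch
  obtain ⟨k, hk⟩ := harch
  have hkp : (0 : R) ≤ k • p := nsmul_nonneg hp k
  have hkpu : (k • p) * u = k • p := by rw [smul_mul_assoc, hpu]
  have hx0 : (0 : R) ≤ (k • p - u)⁺ := posPart_nonneg _
  have hxk : (k • p - u)⁺ ≤ k • p := sup_le (sub_le_self _ hu) hkp
  have hxu := mul_eq_self_of_le hu1 hx0 hxk hkpu
  have hs0 : (0 : R) ≤ (k • p - u)⁺ ⊓ u := le_inf hx0 hu
  have hq0 : (0 : R) ≤ k • p ⊓ u := le_inf hkp hu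
  refine ⟨k, (k • p - u)⁺ ⊓ u, k • p ⊓ u, hs0, inf_le_right, hq0, inf_le_right,
    inf_le_left.trans hxk, inf_le_left, fun h0 => hk ?_, ?_,
    mul_eq_self_of_le hu1 hq0 inf_le_left hkpu⟩
  · have h1 := mul_eq_zero_of_inf_eq_zero hmul hbdd hx0 hu h0
    rw [hxu, posPart_eq_zero, sub_nonpos] at h1
    exact h1
  · have h1 : ((k • p - u)⁺ ⊓ u) * (k • p - u)⁻ = 0 :=
      mul_eq_zero_of_le hmul hs0 (negPart_nonneg _) inf_le_left
        (posPart_mul_negPart hmul hbdd (k • p - u))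
    rw [← sub_inf_eq_negPart, mul_sub, mul_eq_self_of_le hu1 hs0 (inf_le_left.trans hxk) hkpu,
      sub_eq_zero] at h1
    exact h1.symm

end LatticeRing

end WeylGroupoid

namespace WeylGroupoid

/-! ### The order on the ring and the function-like behaviour of `L` -/

section Order

variable {A : Type*} [NonUnitalRing A] [StarRing A]

theorem Le.refl (a : A) : Le a a := by
  simpa [Le] using bracket_zero

theorem Le.trans {a b c : A} (h1 : Le a b) (h2 : Le b c) : Le a c := by
  simpa [Le] using bracket_add_eq_zero h1 h2

theorem Le.add {a b c d : A} (h1 : Le a b) (h2 : Le c d) : Le (a + c) (b + d) := by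
  have h := bracket_add_eq_zero h1 h2
  have e : a + c - (b + d) = a - b + (c - d) := by abel
  rwa [← e] at h

theorem Le.antisymm (hA : IsInfinitesimalFree A) {a b : A} (h1 : Le a b) (h2 : Le b a) :
    a = b := by
  refine sub_eq_zero.1 (hA _ h1 ?_)
  rw [neg_sub]
  exact h2

theorem le_zero_sub_iff {a b : A} : Le 0 (b - a) ↔ Le a b := by
  simp [Le]

theorem le_star_mul_self (s : A) : Le 0 (star s * s) := by
  simpa [Le] using bracket_neg_star_mul_self s

theorem le_of_nsmul_le {a b : A} {n : ℕ} (hn : 0 < n) (h : Le (n • a) (n • b)) : Le a b := by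
  refine bracket_eq_zero_of_nsmul hn ?_
  rw [smul_sub]
  exact h

theorem star_eq_of_le_zero (hA : IsInfinitesimalFree A) {a : A} (h : Le 0 a) : star a = a := by
  have h1 := star_eq_of_bracket_eq_zero hA h
  simpa using h1

theorem eq_zero_of_star_mul_self (hA : IsProper A) {a : A} (h : star a * a = 0) : a = 0 := by
  have h1 := hA (star a) (by simpa using h)
  simpa using h1

theorem star_unit {u : A} (hu : ∀ a : A, u * a = a ∧ a * u = a) : star u = u := by
  have h1 : star u * u = star u := (hu _).2
  have h2 := congrArg star h1
  rw [star_mul, star_star, h1] at h2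
  exact h2

namespace StandingAssumption

variable {S E : Set A} {L : NonUnitalSubring A} (h : StandingAssumption S E L)

include h

/-- `x` is the difference of the positive elements `x ⊔ 0` and `x ⊔ 0 - x`. -/
theorem star_eq {x : A} (hx : x ∈ L) : star x = x := by
  obtain ⟨z, -, h1, h2, -⟩ := (h.lattice x hx 0 L.zero_mem).1
  have h3 := star_eq_of_bracket_eq_zero h.infinitesimalFree h1
  have h4 := star_eq_of_le_zero h.infinitesimalFree h2
  rw [star_sub, h4] at h3
  simpa using h3

theorem sumSquares_mul_mem {x y : A} (hx : x ∈ sumSquares (L : Set A))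
    (hy : y ∈ sumSquares (L : Set A)) : x * y ∈ sumSquares (L : Set A) := by
  refine AddSubsemigroup.closure_induction
    (p := fun x _ => x * y ∈ sumSquares (L : Set A)) ?_ ?_ hx
  · rintro x ⟨s, hs, rfl⟩
    refine AddSubsemigroup.closure_induction
      (p := fun y _ => star s * s * y ∈ sumSquares (L : Set A)) ?_ ?_ hy
    · rintro y ⟨t, ht, rfl⟩
      have e : star s * s * (star t * t) = star (s * t) * (s * t) := by
        simp only [h.star_eq hs, h.star_eq ht, h.star_eq (L.mul_mem hs ht)]
        rw [mul_assoc, mul_assoc, ← mul_assoc s t t, h.comm s hs t ht, mul_assoc, h.comm s hs t ht]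
      rw [e]
      exact star_mul_self_mem_sumSquares (L.mul_mem hs ht)
    · intro y z _ _ h1 h2
      rw [mul_add]
      exact add_mem_sumSquares h1 h2
  · intro x z _ _ h1 h2
    rw [add_mul]
    exact add_mem_sumSquares h1 h2

theorem mul_nonneg {x y : A} (hx : x ∈ L) (hy : y ∈ L) (hx0 : Le 0 x) (hy0 : Le 0 y) :
    Le 0 (x * y) := by
  rcases h.positivity with hp | ⟨-, hp⟩
  · have h1 : x ∈ fractions (sumSquares (L : Set A)) := hp ▸ ⟨hx, hx0⟩
    have h2 : y ∈ fractions (sumSquares (L : Set A)) := hp ▸ ⟨hy, hy0⟩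
    obtain ⟨n, hn, h1⟩ := h1
    obtain ⟨m, hm, h2⟩ := h2
    have h3 : x * y ∈ pos (L : Set A) := by
      rw [hp]
      refine ⟨n * m, by positivity, ?_⟩
      have h4 := h.sumSquares_mul_mem h1 h2
      rwa [smul_mul_smul_comm] at h4
    exact h3.2
  · refine (hp x ⟨trivial, hx0⟩ y ⟨trivial, hy0⟩ ?_).2
    exact h.star_eq (L.mul_mem hx hy)

/-- Under the first alternative a multiple of `y` is a sum of squares `c* c`, and `c* x c ≤ N c* c`.
In the unital case `N - x` is positive and so is its self-adjoint product with `y`. -/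
theorem mul_le_nsmul {x y : A} {N : ℕ} (hx : x ∈ L) (hy : y ∈ L) (hxN : bracket x ≤ N)
    (hy0 : Le 0 y) : Le (y * x) (N • y) := by
  rcases h.positivity with hp | ⟨⟨u, hu⟩, hp⟩
  · have h2 : y ∈ fractions (sumSquares (L : Set A)) := hp ▸ ⟨hy, hy0⟩
    obtain ⟨n, hn, h2⟩ := h2
    have key : Le (n • y * x) (N • (n • y)) := by
      refine AddSubsemigroup.closure_induction (p := fun y _ => Le (y * x) (N • y)) ?_ ?_ h2
      · rintro z ⟨c, hc, rfl⟩
        have h3 := le_conjugate_of_bracket_le h.archimedean hxN (star c)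
        rw [star_star] at h3
        rwa [mul_assoc, h.comm c hc x hx, ← mul_assoc]
      · intro z w _ _ h3 h4
        rw [add_mul, smul_add]
        exact h3.add h4
    refine le_of_nsmul_le hn ?_
    rwa [smul_mul_assoc, smul_comm N n] at key
  · have h1 := le_conjugate_of_bracket_le h.archimedean hxN u
    rw [star_unit hu, (hu _).1, (hu _).2, (hu _).2] at h1
    have e : y * (N • u - x) = N • y - y * x := by
      rw [mul_sub, mul_smul_comm, (hu _).2]
    have h2 := (hp y ⟨trivial, hy0⟩ (N • u - x) ⟨trivial, le_zero_sub_iff.2 h1⟩ (by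
      rw [e]
      exact h.star_eq (L.sub_mem (L.nsmul_mem hy N) (L.mul_mem hy hx)))).2
    rw [e] at h2
    exact le_zero_sub_iff.1 h2

theorem exists_bound {x : A} (hx : x ∈ L) (hx0 : Le 0 x) :
    ∃ N : ℕ, ∀ y ∈ L, Le 0 y → Le (y * x) (N • y) := by
  obtain ⟨N, hN⟩ := exists_of_bracket_lt_top (h.archimedean x (by simpa [Le] using hx0))
  exact ⟨N, fun y hy hy0 => h.mul_le_nsmul hx hy hN hy0⟩

theorem sq_mem {s : A} (hs : s ∈ S) : star s * s ∈ L :=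
  h.hereditary.1 ⟨s, hs, rfl⟩

theorem mul_sq_le {s x : A} (hs : s ∈ S) (hx : x ∈ L) (hx0 : Le 0 x) :
    Le (x * (star s * s)) x := by
  have h1 := h.mul_le_nsmul (h.sq_mem hs) hx
    (bracket_le_one_of_mem_unitBall (h.subset_unitBall hs)) hx0
  rwa [one_smul] at h1

end StandingAssumption

end Order

/-! ### Transfer of the lattice-ring lemmas to `L` -/

section Transfer

variable {A : Type*} [NonUnitalRing A] [StarRing A]

namespace StandingAssumption

variable {S E : Set A} {L : NonUnitalSubring A} (h : StandingAssumption S E L)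

/-- `L` as a commutative ring. -/
@[reducible] def commRing : NonUnitalCommRing L :=
  { (inferInstance : NonUnitalRing L) with
    mul_comm := fun x y => Subtype.ext (h.comm x x.2 y y.2) }

/-- `L` as a lattice. -/
@[reducible] noncomputable def toLattice : Lattice L where
  le x y := Le (x : A) y
  le_refl x := Le.refl _
  le_trans _ _ _ h1 h2 := h1.trans h2
  le_antisymm _ _ h1 h2 := Subtype.ext (h1.antisymm h.infinitesimalFree h2)
  sup x y := ⟨(h.lattice x x.2 y y.2).1.choose, (h.lattice x x.2 y y.2).1.choose_spec.1⟩
  le_sup_left x y := (h.lattice x x.2 y y.2).1.choose_spec.2.1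
  le_sup_right x y := (h.lattice x x.2 y y.2).1.choose_spec.2.2.1
  sup_le x y z h1 h2 := (h.lattice x x.2 y y.2).1.choose_spec.2.2.2 z z.2 h1 h2
  inf x y := ⟨(h.lattice x x.2 y y.2).2.choose, (h.lattice x x.2 y y.2).2.choose_spec.1⟩
  inf_le_left x y := (h.lattice x x.2 y y.2).2.choose_spec.2.1
  inf_le_right x y := (h.lattice x x.2 y y.2).2.choose_spec.2.2.1
  le_inf x y z h1 h2 := (h.lattice y y.2 z z.2).2.choose_spec.2.2.2 x x.2 h1 h2

include h

theorem exists_interpolants {q u : A} (hq : q ∈ L) (hu : u ∈ L) (hq0 : Le 0 q) (hu0 : Le 0 u)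
    (hqle : Le q u) (hu1 : ∀ x ∈ L, Le 0 x → Le (x * u) x) (hqu : q * u = q) :
    ∃ s ∈ L, ∃ t ∈ L, Le 0 s ∧ Le s u ∧ Le 0 t ∧ Le t u ∧ s * t = s ∧ s * u = s ∧ t * u = t ∧
      ∀ x ∈ L, Le 0 x → x * q = x → x * s = x := by
  let _ := h.commRing
  let _ := h.toLattice
  have : IsOrderedAddMonoid L :=
    { add_le_add_left := fun a b hab c => Le.add hab (Le.refl (c : A)) }
  obtain ⟨s, t, h1, h2, h3, h4, h5, h6, h7, h8⟩ := WeylGroupoid.exists_interpolants (R := L)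
    (fun x y hx hy => h.mul_nonneg x.2 y.2 hx hy)
    (fun x hx => (h.exists_bound x.2 hx).imp fun N hN y hy => hN y y.2 hy)
    (q := ⟨q, hq⟩) (u := ⟨u, hu⟩) hq0 hu0 hqle (fun x hx => hu1 x x.2 hx) (Subtype.ext hqu)
  exact ⟨s, s.2, t, t.2, h1, h2, h3, h4, congrArg Subtype.val h5, congrArg Subtype.val h6,
    congrArg Subtype.val h7, fun x hx hx0 hxq =>
      congrArg Subtype.val (h8 ⟨x, hx⟩ hx0 (Subtype.ext hxq))⟩

theorem exists_ne_zero_unit {p u : A} {N : ℕ} (hp : p ∈ L) (hu : u ∈ L) (hp0 : Le 0 p)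
    (hu0 : Le 0 u) (hu1 : ∀ x ∈ L, Le 0 x → Le (x * u) x) (hpu : p * u = p)
    (huN : bracket u ≤ N) (hp1 : p ≠ 0) :
    ∃ k : ℕ, ∃ s ∈ L, ∃ q ∈ L, Le 0 s ∧ Le s u ∧ Le 0 q ∧ Le q u ∧ Le s (k • p) ∧
      Le q (k • p) ∧ s ≠ 0 ∧ s * q = s ∧ q * u = q := by
  let _ := h.commRing
  let _ := h.toLattice
  have : IsOrderedAddMonoid L :=
    { add_le_add_left := fun a b hab c => Le.add hab (Le.refl (c : A)) }
  obtain ⟨k, s, q, h1, h2, h3, h4, h5, h6, h7, h8, h9⟩ :=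
    WeylGroupoid.exists_ne_zero_unit (R := L)
    (fun x y hx hy => h.mul_nonneg x.2 y.2 hx hy)
    (fun x hx => (h.exists_bound x.2 hx).imp fun N hN y hy => hN y y.2 hy)
    (p := ⟨p, hp⟩) (u := ⟨u, hu⟩) hp0 hu0 (fun x hx => hu1 x x.2 hx) (Subtype.ext hpu)
    (fun hk => hp1 (eq_zero_of_forall_nsmul_le h.infinitesimalFree huN hp0 hk))
  exact ⟨k, s, s.2, q, q.2, h1, h2, h3, h4, h5, h6, fun h0 => h7 (Subtype.ext h0),
    congrArg Subtype.val h8, congrArg Subtype.val h9⟩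

end StandingAssumption

end Transfer

end WeylGroupoid

/-! ### Calculus of `≾`, filters and the topology -/

namespace WeylGroupoid

variable {A : Type*} [NonUnitalRing A] [StarRing A]

theorem StarDom.sq_mul_sq {E : Set A} {a b : A} (hab : StarDom E a b) :
    star a * a * (star b * b) = star a * a := by
  rw [mul_assoc, ← hab.2]

namespace IsWeylStarSemigroup

variable {S E : Set A} (h : IsWeylStarSemigroup S E)

include h

theorem star_mul_self_mem {a : A} (ha : a ∈ S) : star a * a ∈ E :=
  h.squares_mem ⟨a, ha, rfl⟩

theorem mul_star_self_mem {a : A} (ha : a ∈ S) : a * star a ∈ E := by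
  simpa using h.star_mul_self_mem (h.star_mem a ha)

theorem conj_mem {a e : A} (ha : a ∈ S) (he : e ∈ E) : a * e * star a ∈ E := by
  simpa using h.normal (star a) (h.star_mem a ha) e he

theorem star_mul_self_comm {a e : A} (ha : a ∈ S) (he : e ∈ E) :
    star a * a * e = e * (star a * a) :=
  h.squares_comm _ ⟨a, ha, rfl⟩ e he

theorem mul_star_self_comm {a e : A} (ha : a ∈ S) (he : e ∈ E) :
    a * star a * e = e * (a * star a) := by
  simpa using h.star_mul_self_comm (h.star_mem a ha) he

theorem compat_refl {a : A} (ha : a ∈ S) : Compat E a a := h.mul_star_self_mem ha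

theorem compat_symm {a b : A} (hab : Compat E a b) : Compat E b a := by
  simpa [Compat] using h.star_mem_E _ hab

theorem starDom_trans {a b c : A} (hab : StarDom E a b) (hbc : StarDom E b c) :
    StarDom E a c := by
  constructor
  · have e : a * star c = a * star b * (b * star c) := by
      conv_lhs => rw [hab.2]
      simp only [mul_assoc]
    change a * star c ∈ E
    rw [e]
    exact h.mul_mem_E _ hab.1 _ hbc.1
  · calc a = a * (star b * b) := hab.2
      _ = a * (star b * (b * (star c * c))) := by rw [← hbc.2]
      _ = a * (star b * b) * (star c * c) := by simp only [mul_assoc]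
      _ = a * (star c * c) := by rw [← hab.2]

/-- Left-handed domination, needed for the involution: `a = (a b*) b`, and `b b*` commutes with `a
b* ∈ E`. -/
theorem mul_star_mul_eq {a b : A} (hb : b ∈ S) (hab : StarDom E a b) :
    b * star b * a = a := by
  have h1 : a * star b * (b * star b) = a * star b := by
    conv_rhs => rw [hab.2]
    simp only [mul_assoc]
  calc b * star b * a = b * star b * (a * star b) * b := by
        conv_lhs => rw [hab.2]
        simp only [mul_assoc]
    _ = a * star b * (b * star b) * b := by rw [h.mul_star_self_comm hb hab.1]
    _ = a := by
        rw [h1, mul_assoc]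
        exact hab.2.symm

theorem starDom_star {a b : A} (hb : b ∈ S) (hab : StarDom E a b) :
    StarDom E (star a) (star b) := by
  constructor
  · have e : star a * b = star b * (b * star a) * b := by
      have := congrArg star hab.2
      conv_lhs => rw [this]
      simp [mul_assoc]
    change star a * star (star b) ∈ E
    rw [star_star, e]
    exact h.normal b hb _ (h.compat_symm hab.1)
  · change star a = star a * (star (star b) * star b)
    have := congrArg star (h.mul_star_mul_eq hb hab)
    simp only [star_mul, star_star] at this
    rw [star_star]
    exact this.symm

theorem starDom_mul {a b a' b' : A} (hb : b ∈ S) (hab : StarDom E a b)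
    (hab' : StarDom E a' b') : StarDom E (a * a') (b * b') := by
  constructor
  · have e : a * a' * star (b * b') = a * star b * (b * (a' * star b') * star b) := by
      conv_lhs => rw [hab.2]
      simp only [mul_assoc, star_mul]
    change a * a' * star (b * b') ∈ E
    rw [e]
    exact h.mul_mem_E _ hab.1 _ (h.conj_mem hb hab'.1)
  · have h1 := h.star_mul_self_comm hb hab'.1
    change a * a' = a * a' * (star (b * b') * (b * b'))
    symm
    calc a * a' * (star (b * b') * (b * b'))
        = a * (a' * star b' * (star b * b)) * b' := by simp only [mul_assoc, star_mul]
      _ = a * (star b * b) * (a' * (star b' * b')) := by rw [← h1]; simp only [mul_assoc]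
      _ = a * a' := by rw [← hab.2, ← hab'.2]

theorem starDom_star_mul_self {a b : A} (hb : b ∈ S) (hab : StarDom E a b) :
    StarDom E (star a * a) (star b * b) :=
  h.starDom_mul (h.star_mem b hb) (h.starDom_star hb hab) hab

end IsWeylStarSemigroup

namespace IsStarFilter

variable {S E U : Set A} (hU : IsStarFilter S E U)

include hU

theorem up {c s : A} (hc : c ∈ U) (hs : s ∈ S) (hcs : StarDom E c s) : s ∈ U :=
  ((hU.mem_iff s hs s hs).2 ⟨c, hc, hcs, hcs⟩).1

theorem directed {s t : A} (hs : s ∈ U) (ht : t ∈ U) :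
    ∃ c ∈ U, StarDom E c s ∧ StarDom E c t :=
  (hU.mem_iff s (hU.subset hs) t (hU.subset ht)).1 ⟨hs, ht⟩

theorem exists_starDom {s : A} (hs : s ∈ U) : ∃ c ∈ U, StarDom E c s :=
  (hU.directed hs hs).imp fun _ h => ⟨h.1, h.2.1⟩

end IsStarFilter

theorem exists_mem_basicOpen_subset {S E : Set A} {O : Set (Ultrafilters S E)} (hO : IsOpen O) {U : Ultrafilters S E} (hU : U ∈ O) :
    ∃ t ∈ U.1, basicOpen S E t ⊆ O := by
  induction hO with
  | basic W h =>
    obtain ⟨a, -, rfl⟩ := h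
    exact ⟨a, hU, subset_rfl⟩
  | univ =>
    obtain ⟨t, ht⟩ := U.2.isFilter.nonempty
    exact ⟨t, ht, Set.subset_univ _⟩
  | inter O₁ O₂ _ _ h1 h2 =>
    obtain ⟨s, hs, hs'⟩ := h1 hU.1
    obtain ⟨t, ht, ht'⟩ := h2 hU.2
    obtain ⟨c, hc, hcs, hct⟩ := U.2.isFilter.directed hs ht
    exact ⟨c, hc, fun V hV => ⟨hs' (V.2.isFilter.up hV (U.2.isFilter.subset hs) hcs),
      ht' (V.2.isFilter.up hV (U.2.isFilter.subset ht) hct)⟩⟩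
  | sUnion C _ h1 =>
    obtain ⟨W, hWC, hUW⟩ := hU
    obtain ⟨t, ht, ht'⟩ := h1 W hWC hUW
    exact ⟨t, ht, ht'.trans (Set.subset_sUnion_of_mem hWC)⟩

theorem isOpen_basicOpen {S E : Set A} {a : A} (ha : a ∈ S) : IsOpen (basicOpen S E a) :=
  TopologicalSpace.isOpen_generateFrom_of_mem ⟨a, ha, rfl⟩

theorem CompactlyContained.subset {X : Type*} [TopologicalSpace X] {O N : Set X}
    (h : CompactlyContained O N) (hN : IsOpen N) : O ⊆ N := by
  obtain ⟨F, hF, -, hO⟩ := h {N} (by simpa using hN) (by simp)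
  exact hO.trans (by simpa using Set.sUnion_mono hF)

/-! ### Interpolation in `S` and existence of ultrafilters -/

namespace StandingAssumption

variable {S E : Set A} {L : NonUnitalSubring A} (h : StandingAssumption S E L)

include h

theorem mem_of_le {x s : A} (hx : x ∈ L) (hx0 : Le 0 x) (hs : s ∈ S)
    (hxs : Le x (star s * s)) : x ∈ S :=
  h.hereditary.2 x ⟨hx, hx0⟩ ⟨_, ⟨s, hs, rfl⟩, hxs⟩

theorem zero_mem {s : A} (hs : s ∈ S) : (0 : A) ∈ S :=
  h.mem_of_le L.zero_mem (Le.refl 0) hs (le_star_mul_self s)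

theorem zero_mem_E {s : A} (hs : s ∈ S) : (0 : A) ∈ E := by
  simpa using h.weyl.star_mul_self_mem (h.zero_mem hs)

theorem mul_self_mem_E {x : A} (hx : x ∈ L) (hxS : x ∈ S) : x * x ∈ E := by
  have := h.weyl.star_mul_self_mem hxS
  rwa [h.star_eq hx] at this

theorem starDom_mul_right {g f X Y : A} (hf : f ∈ S) (hgf : Compat E g f) (hX : X ∈ L)
    (hY : Y ∈ L) (hXE : X ∈ E) (hXY : X * Y = X) (hXf : X * (star f * f) = X) :
    StarDom E (g * X) (f * Y) := by
  have hfX : star f * f * X = X := by rw [h.comm _ (h.sq_mem hf) X hX, hXf]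
  constructor
  · have e : g * X * star (f * Y) = g * star f * (f * X * star f) := by
      calc g * X * star (f * Y) = g * (X * Y) * star f := by
            rw [star_mul, h.star_eq hY]; simp only [mul_assoc]
        _ = g * (star f * f * X) * star f := by rw [hXY, hfX]
        _ = _ := by simp only [mul_assoc]
    change g * X * star (f * Y) ∈ E
    rw [e]
    exact h.weyl.mul_mem_E _ hgf _ (h.weyl.conj_mem hf hXE)
  · change g * X = g * X * (star (f * Y) * (f * Y))
    symm
    calc g * X * (star (f * Y) * (f * Y)) = g * (X * Y * (star f * f) * Y) := by
          rw [star_mul, h.star_eq hY]; simp only [mul_assoc]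
      _ = g * X := by rw [hXY, hXf, hXY]

theorem starDom_mul_left {g f X : A} (hf : f ∈ S) (hgf : Compat E g f) (hX : X ∈ L)
    (hXE : X ∈ E) (hXf : X * (star f * f) = X) : StarDom E (g * X) f := by
  have hfX : star f * f * X = X := by rw [h.comm _ (h.sq_mem hf) X hX, hXf]
  constructor
  · have e : g * X * star f = g * star f * (f * X * star f) := by
      conv_lhs => rw [← hfX]
      simp only [mul_assoc]
    change g * X * star f ∈ E
    rw [e]
    exact h.weyl.mul_mem_E _ hgf _ (h.weyl.conj_mem hf hXE)
  · change g * X = g * X * (star f * f)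
    rw [mul_assoc, hXf]

theorem starDom_of_mul_eq {d f Y : A} (hf : f ∈ S) (hdf : StarDom E d f) (hY : Y ∈ L)
    (hYE : Y ∈ E) (hdY : d * Y = d) : StarDom E d (f * Y) := by
  have hd := hdf.2
  constructor
  · have e : d * star (f * Y) = d * star f * (f * Y * star f) := by
      calc d * star (f * Y) = d * (star f * f) * star (f * Y) := by rw [← hd]
        _ = _ := by rw [star_mul, h.star_eq hY]; simp only [mul_assoc]
    change d * star (f * Y) ∈ E
    rw [e]
    exact h.weyl.mul_mem_E _ hdf.1 _ (h.weyl.conj_mem hf hYE)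
  · change d = d * (star (f * Y) * (f * Y))
    symm
    calc d * (star (f * Y) * (f * Y)) = d * Y * (star f * f) * Y := by
          rw [star_mul, h.star_eq hY]; simp only [mul_assoc]
      _ = d := by rw [hdY, ← hd, hdY]

theorem mul_eq_self_of_sq {d x : A} (hx : x ∈ L) (hdx : star d * d * x = star d * d) :
    d * x = d := by
  have h1 : x * (star d * d) = star d * d := by
    have := congrArg star hdx
    simpa [h.star_eq hx] using this
  refine (sub_eq_zero.1 (eq_zero_of_star_mul_self h.proper ?_)).symm
  have e : star (d - d * x) * (d - d * x)
      = star d * d - star d * d * x - x * (star d * d) + x * (star d * d * x) := by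
    rw [star_sub, star_mul, h.star_eq hx]
    simp only [mul_sub, sub_mul, mul_assoc]
    abel
  rw [e, hdx, h1]
  abel

/-- The interpolants `s`, `t` between `c* c` and `b* b` give `b s² ≾ b t² ≾ b`. -/
theorem exists_starDom_between {c b : A} (hc : c ∈ S) (hb : b ∈ S) (hcb : StarDom E c b) :
    ∃ e ∈ S, ∃ f ∈ S, StarDom E e f ∧ StarDom E f b ∧
      ∀ d ∈ S, StarDom E d c → StarDom E d e := by
  have hqu := hcb.sq_mul_sq
  have hle : Le (star c * c) (star b * b) := by
    have h1 := h.mul_sq_le hc (h.sq_mem hb) (le_star_mul_self b)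
    rwa [h.comm _ (h.sq_mem hb) _ (h.sq_mem hc), hqu] at h1
  obtain ⟨s, hs, t, ht, hs0, hsu, ht0, htu, hst, hsu', htu', hx⟩ :=
    h.exists_interpolants (h.sq_mem hc) (h.sq_mem hb) (le_star_mul_self c) (le_star_mul_self b)
      hle (fun x hx hx0 => h.mul_sq_le hb hx hx0) hqu
  have hsS := h.mem_of_le hs hs0 hb hsu
  have htS := h.mem_of_le ht ht0 hb htu
  -- Squares are taken because `s` and `t` are only known to lie in `S`, whereas `s² = s* s` and `t²
  -- = t* t` lie in `E`.
  refine ⟨b * (s * s), h.weyl.mul_mem _ hb _ (h.weyl.mul_mem _ hsS _ hsS),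
    b * (t * t), h.weyl.mul_mem _ hb _ (h.weyl.mul_mem _ htS _ htS), ?_, ?_, fun d hdS hd => ?_⟩
  · refine h.starDom_mul_right hb (h.weyl.compat_refl hb) (L.mul_mem hs hs) (L.mul_mem ht ht)
      (h.mul_self_mem_E hs hsS) ?_ ?_
    · rw [mul_assoc, ← mul_assoc s t, hst, ← mul_assoc, mul_assoc, hst]
    · rw [mul_assoc, hsu']
  · refine h.starDom_mul_left hb (h.weyl.compat_refl hb) (L.mul_mem ht ht)
      (h.mul_self_mem_E ht htS) ?_
    rw [mul_assoc, htu']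
  · have h1 : d * s = d := h.mul_eq_self_of_sq hs
      (hx _ (h.sq_mem hdS) (le_star_mul_self d) hd.sq_mul_sq)
    refine h.starDom_of_mul_eq hb (h.weyl.starDom_trans hd hcb) (L.mul_mem hs hs)
      (h.mul_self_mem_E hs hsS) ?_
    rw [← mul_assoc, h1, h1]

/-- The iteration carries a pair `e ≾ f` and interpolates between its entries, so everything below
`c` stays below every term. A chain is needed because `≾` is not reflexive, while members of a
filter must dominate other members. -/
theorem exists_chain {c b : A} (hc : c ∈ S) (hb : b ∈ S) (hcb : StarDom E c b) :
    ∃ f : ℕ → A, (∀ k, f k ∈ S) ∧ (∀ k, StarDom E (f k) b) ∧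
      (∀ k l, k < l → StarDom E (f l) (f k)) ∧
      ∀ k, ∀ d ∈ S, StarDom E d c → StarDom E d (f k) := by
  let P : Type _ := {p : A × A // p.1 ∈ S ∧ p.2 ∈ S ∧ StarDom E p.1 p.2 ∧ StarDom E p.2 b ∧
    ∀ d ∈ S, StarDom E d c → StarDom E d p.1}
  have step : ∀ p : P, ∃ p' : P, StarDom E p'.1.2 p.1.2 := by
    rintro ⟨⟨x, y⟩, hx, hy, hxy, hyb, hd⟩
    obtain ⟨e, he, f, hf, hef, hfy, hd'⟩ := h.exists_starDom_between hx hy hxy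
    exact ⟨⟨(e, f), he, hf, hef, h.weyl.starDom_trans hfy hyb,
      fun d hdS hdc => hd' d hdS (hd d hdS hdc)⟩, hfy⟩
  choose next hnext using step
  obtain ⟨e, he, f, hf, hef, hfy, hd'⟩ := h.exists_starDom_between hc hb hcb
  let p : ℕ → P := fun n => Nat.rec ⟨(e, f), he, hf, hef, hfy, hd'⟩ (fun _ q => next q) n
  refine ⟨fun k => (p k).1.2, fun k => (p k).2.2.1, fun k => (p k).2.2.2.2.1,
    fun k l hkl => ?_, fun k d hdS hdc =>
      h.weyl.starDom_trans ((p k).2.2.2.2.2 d hdS hdc) (p k).2.2.2.1⟩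
  induction l, hkl using Nat.le_induction with
  | base => exact hnext (p k)
  | succ l _ ih => exact h.weyl.starDom_trans (hnext (p l)) ih

theorem eq_univ_of_zero_mem {U : Set A} (hU : IsStarFilter S E U) (h0 : (0 : A) ∈ U) :
    U = S := by
  refine hU.subset.antisymm fun s hs => hU.up h0 hs ⟨?_, ?_⟩
  · change 0 * star s ∈ E
    rw [zero_mul]
    exact h.zero_mem_E hs
  · change (0 : A) = 0 * _
    rw [zero_mul]

theorem zero_notMem {U : Set A} (hU : IsStarUltrafilter S E U) : (0 : A) ∉ U :=
  fun h0 => hU.proper (h.eq_univ_of_zero_mem hU.isFilter h0)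

/-- The upward closure of `B` is a filter, and Zorn's lemma applies to the filters omitting `0`,
which are the proper ones. -/
theorem exists_ultrafilter {B : Set A} (hBS : B ⊆ S) (hne : B.Nonempty) (h0 : (0 : A) ∉ B)
    (hdir : ∀ x ∈ B, ∀ y ∈ B, ∃ z ∈ B, StarDom E z x ∧ StarDom E z y) :
    ∃ V : Ultrafilters S E, B ⊆ V.1 := by
  have h0S : (0 : A) ∈ S := h.zero_mem (hBS hne.some_mem)
  let F : Set A := {s | s ∈ S ∧ ∃ x ∈ B, StarDom E x s}
  have hBF : B ⊆ F := fun x hx => by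
    obtain ⟨z, hz, hzx, -⟩ := hdir x hx x hx
    exact ⟨hBS hx, z, hz, hzx⟩
  have hF : IsStarFilter S E F := by
    refine ⟨fun x hx => hx.1, hne.mono hBF, fun a ha b hb => ⟨?_, ?_⟩⟩
    · rintro ⟨⟨-, x, hx, hxa⟩, -, y, hy, hyb⟩
      obtain ⟨z, hz, hzx, hzy⟩ := hdir x hx y hy
      exact ⟨z, hBF hz, h.weyl.starDom_trans hzx hxa, h.weyl.starDom_trans hzy hyb⟩
    · rintro ⟨c, ⟨-, x, hx, hxc⟩, hca, hcb⟩
      exact ⟨⟨ha, x, hx, h.weyl.starDom_trans hxc hca⟩, hb, x, hx,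
        h.weyl.starDom_trans hxc hcb⟩
  have hF0 : (0 : A) ∉ F := by
    rintro ⟨-, x, hx, hx0⟩
    have : x = 0 := by simpa [Dom] using hx0.2
    exact h0 (this ▸ hx)
  obtain ⟨V, hFV, hV⟩ := zorn_subset_nonempty {V : Set A | IsStarFilter S E V ∧ (0 : A) ∉ V}
    (by
      intro c hc hchain hcne
      refine ⟨⋃₀ c, ⟨⟨Set.sUnion_subset fun V hV => (hc hV).1.subset, ?_, ?_⟩, ?_⟩,
        fun V hV => Set.subset_sUnion_of_mem hV⟩
      · obtain ⟨V, hV⟩ := hcne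
        exact (hc hV).1.nonempty.mono (Set.subset_sUnion_of_mem hV)
      · refine fun a ha b hb => ⟨?_, ?_⟩
        · rintro ⟨⟨V, hV, haV⟩, W, hW, hbW⟩
          rcases hchain.total hV hW with hVW | hWV
          · obtain ⟨z, hz, hz'⟩ := (hc hW).1.directed (hVW haV) hbW
            exact ⟨z, ⟨W, hW, hz⟩, hz'⟩
          · obtain ⟨z, hz, hz'⟩ := (hc hV).1.directed haV (hWV hbW)
            exact ⟨z, ⟨V, hV, hz⟩, hz'⟩
        · rintro ⟨z, ⟨V, hV, hz⟩, hza, hzb⟩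
          exact ⟨⟨V, hV, (hc hV).1.up hz ha hza⟩, V, hV, (hc hV).1.up hz hb hzb⟩
      · rintro ⟨V, hV, h0V⟩
        exact (hc hV).2 h0V) F ⟨hF, hF0⟩
  refine ⟨⟨V, hV.prop.1, fun hVS => hV.prop.2 (hVS ▸ h0S), fun W hW hWS hVW => ?_⟩,
    hBF.trans hFV⟩
  exact (hV.le_of_ge ⟨hW, fun h0W => hWS (h.eq_univ_of_zero_mem hW h0W)⟩ hVW).antisymm hVW

end StandingAssumption

end WeylGroupoid

/-! ### Finite joins of squares, covers and annihilators -/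

namespace WeylGroupoid

variable {A : Type*} [NonUnitalRing A] [StarRing A]

/-- `1 - ∏ (1 - t* t)`, the product running over the list of elements `t`. -/
def sqJoin : List A → A
  | [] => 0
  | t :: F => star t * t + sqJoin F - sqJoin F * (star t * t)

theorem mul_sqJoin_eq_zero {x : A} {F : List A} (hF : ∀ t ∈ F, x * (star t * t) = 0) :
    x * sqJoin F = 0 := by
  induction F with
  | nil => simp [sqJoin]
  | cons t F ih =>
    rw [List.forall_mem_cons] at hF
    rw [sqJoin, mul_sub, mul_add, ← mul_assoc x (sqJoin F), hF.1, ih hF.2]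
    simp

theorem sqJoin_mul_eq_self {x : A} {F : List A}
    (hF : ∀ t ∈ F, star t * t * x = star t * t) : sqJoin F * x = sqJoin F := by
  induction F with
  | nil => simp [sqJoin]
  | cons t F ih =>
    rw [List.forall_mem_cons] at hF
    rw [sqJoin, sub_mul, add_mul, mul_assoc (sqJoin F), hF.1, ih hF.2]

namespace StandingAssumption

variable {S E : Set A} {L : NonUnitalSubring A} (h : StandingAssumption S E L)

include h

theorem sqJoin_mem {F : List A} (hF : ∀ t ∈ F, t ∈ S) : sqJoin F ∈ L := by
  induction F with
  | nil => exact L.zero_mem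
  | cons t F ih =>
    rw [List.forall_mem_cons] at hF
    exact L.sub_mem (L.add_mem (h.sq_mem hF.1) (ih hF.2)) (L.mul_mem (ih hF.2) (h.sq_mem hF.1))

theorem sqJoin_nonneg {F : List A} (hF : ∀ t ∈ F, t ∈ S) : Le 0 (sqJoin F) := by
  induction F with
  | nil => exact Le.refl 0
  | cons t F ih =>
    rw [List.forall_mem_cons] at hF
    have h1 := le_zero_sub_iff.2 (h.mul_sq_le hF.1 (h.sqJoin_mem hF.2) (ih hF.2))
    have h2 := (le_star_mul_self t).add h1
    rwa [add_zero, ← add_sub_assoc] at h2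

theorem mul_sqJoin_le {F : List A} (hF : ∀ t ∈ F, t ∈ S) {x : A} (hx : x ∈ L) (hx0 : Le 0 x) :
    Le (x * sqJoin F) x := by
  induction F with
  | nil => simpa [sqJoin] using hx0
  | cons t F ih =>
    rw [List.forall_mem_cons] at hF
    have h1 := h.mul_sq_le hF.1 (L.sub_mem hx (L.mul_mem hx (h.sqJoin_mem hF.2)))
      (le_zero_sub_iff.2 (ih hF.2))
    have e : x - x * sqJoin (t :: F)
        = x - x * sqJoin F - (x - x * sqJoin F) * (star t * t) := by
      rw [sqJoin]
      simp only [mul_sub, mul_add, sub_mul, mul_assoc]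
      abel
    rw [← le_zero_sub_iff, e, le_zero_sub_iff]
    exact h1

theorem mul_sqJoin_eq_self {F : List A} (hF : ∀ t ∈ F, t ∈ S) {x t : A} (ht : t ∈ F)
    (hx : x * (star t * t) = x) : x * sqJoin F = x := by
  induction F with
  | nil => simp at ht
  | cons s F ih =>
    rw [List.forall_mem_cons] at hF
    rcases List.mem_cons.1 ht with rfl | ht
    · rw [sqJoin, h.comm _ (h.sqJoin_mem hF.2) _ (h.sq_mem hF.1), mul_sub, mul_add,
        ← mul_assoc x _ (sqJoin F), hx, add_sub_cancel_right]
    · rw [sqJoin, mul_sub, mul_add, ← mul_assoc x (sqJoin F), ih hF.2 ht, add_sub_cancel_left]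

theorem mul_eq_zero_of_le {x y z : A} (hx : x ∈ L) (hy : y ∈ L) (hz : z ∈ L) (hx0 : Le 0 x)
    (hz0 : Le 0 z) (hxy : Le x y) (hyz : y * z = 0) : x * z = 0 := by
  have h1 := h.mul_nonneg (L.sub_mem hy hx) hz (le_zero_sub_iff.2 hxy) hz0
  rw [sub_mul, hyz] at h1
  exact (le_zero_sub_iff.1 h1).antisymm h.infinitesimalFree (h.mul_nonneg hx hz hx0 hz0)

theorem mul_eq_zero_of_sq {d x : A} (hx : x ∈ L) (hdx : star d * d * x = 0) : d * x = 0 := by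
  refine eq_zero_of_star_mul_self h.proper ?_
  rw [star_mul, h.star_eq hx, mul_assoc, ← mul_assoc (star d), hdx, mul_zero]

theorem mul_sq_ne_zero {a x : A} (hx : x ∈ L) (hx0 : x ≠ 0)
    (hxa : star a * a * x = x) : a * (x * x) ≠ 0 := by
  intro h0
  refine hx0 (eq_zero_of_star_mul_self h.proper ?_)
  rw [h.star_eq hx]
  calc x * x = star a * a * x * x := by rw [hxa]
    _ = star a * (a * (x * x)) := by simp only [mul_assoc]
    _ = 0 := by rw [h0, mul_zero]

/-- Every nonzero `p ∈ L₊` with unit `a* a` is bounded below, up to a multiple, on some non-empty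
basic open subset of `𝓤_a`. -/
theorem exists_ultrafilter_of_ne_zero {a p : A} (ha : a ∈ S) (hp : p ∈ L) (hp0 : Le 0 p)
    (hpa : p * (star a * a) = p) (hp1 : p ≠ 0) :
    ∃ (k : ℕ) (q : A), q ∈ L ∧ q ∈ S ∧ Le 0 q ∧ Le q (k • p) ∧ StarDom E (a * (q * q)) a ∧
      ∃ V : Ultrafilters S E, a * (q * q) ∈ V.1 := by
  have hu := h.sq_mem ha
  have hu0 := le_star_mul_self a
  have huN := bracket_le_one_of_mem_unitBall (h.subset_unitBall ha)
  have hcontr := fun x hx hx0 => h.mul_sq_le ha (x := x) hx hx0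
  obtain ⟨k, s, hs, q, hq, hs0, hsu, hq0, hqu, hsp, hqp, hs1, hsq, hqa⟩ :=
    h.exists_ne_zero_unit hp hu hp0 hu0 hcontr hpa huN hp1
  have hsa : s * (star a * a) = s := by rw [← hsq, mul_assoc, hqa]
  -- A second application, below `s`, makes room for a chain between `a q'²` and `a q²`; the nonzero
  -- `a s'²` lies below all of it, which keeps `0` out.
  obtain ⟨k', s', hs', q', hq', hs0', hsu', hq0', hqu', hsp', hqp', hs1', hsq', hqu''⟩ :=
    h.exists_ne_zero_unit hs hu hs0 hu0 hcontr hsa huN hs1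
  have hqS := h.mem_of_le hq hq0 ha hqu
  have hqS' := h.mem_of_le hq' hq0' ha hqu'
  have hqq : q' * q = q' := by
    have h1 : q' * (star a * a - q) = 0 := by
      refine h.mul_eq_zero_of_le hq' (L.nsmul_mem hs k') (L.sub_mem hu hq) hq0'
        (le_zero_sub_iff.2 hqu) hqp' ?_
      rw [smul_mul_assoc, mul_sub, hsa, hsq, sub_self, smul_zero]
    rw [mul_sub, hqu'', sub_eq_zero] at h1
    exact h1.symm
  have hsa' : s' * (star a * a) = s' := by rw [← hsq', mul_assoc, hqu'']
  have hsq2 : ∀ x y : A, x * y = x → x * x * (y * y) = x * x := fun x y hxy => by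
    rw [mul_assoc, ← mul_assoc x y, hxy, ← mul_assoc, mul_assoc, hxy]
  have hfa : StarDom E (a * (q * q)) a :=
    h.starDom_mul_left ha (h.weyl.compat_refl ha) (L.mul_mem hq hq) (h.mul_self_mem_E hq hqS)
      (by rw [mul_assoc, hqa])
  have hef : StarDom E (a * (q' * q')) (a * (q * q)) :=
    h.starDom_mul_right ha (h.weyl.compat_refl ha) (L.mul_mem hq' hq') (L.mul_mem hq hq)
      (h.mul_self_mem_E hq' hqS') (hsq2 _ _ hqq) (by rw [mul_assoc, hqu''])
  have hsS' := h.mem_of_le hs' hs0' ha hsu'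
  have hde : StarDom E (a * (s' * s')) (a * (q' * q')) :=
    h.starDom_mul_right ha (h.weyl.compat_refl ha) (L.mul_mem hs' hs') (L.mul_mem hq' hq')
      (h.mul_self_mem_E hs' hsS') (hsq2 _ _ hsq') (by rw [mul_assoc, hsa'])
  have hmem : ∀ x ∈ S, a * (x * x) ∈ S := fun x hx =>
    h.weyl.mul_mem _ ha _ (h.weyl.mul_mem _ hx _ hx)
  have hd0 : a * (s' * s') ≠ 0 :=
    h.mul_sq_ne_zero hs' hs1' (by rw [h.comm _ hu _ hs', hsa'])
  obtain ⟨f, hfS, hff, hfl, hfd⟩ := h.exists_chain (hmem _ hqS') (hmem _ hqS) hef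
  obtain ⟨V, hV⟩ := h.exists_ultrafilter (B := Set.range f) (by rintro _ ⟨k, rfl⟩; exact hfS k)
    ⟨f 0, 0, rfl⟩ (by
      rintro ⟨k, hk⟩
      have h1 := (hfd k _ (hmem _ hsS') hde).2
      rw [hk] at h1
      exact hd0 (by simpa [Dom] using h1)) (by
      rintro _ ⟨k, rfl⟩ _ ⟨l, rfl⟩
      exact ⟨f (max k l + 1), ⟨_, rfl⟩, hfl _ _ (by omega), hfl _ _ (by omega)⟩)
  exact ⟨k, q, hq, hqS, hq0, hqp, hfa, V, V.2.isFilter.up (hV ⟨0, rfl⟩) (hmem _ hqS) (hff 0)⟩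

/-- Otherwise `d* d (1 - sqJoin F)` is nonzero and some ultrafilter containing `a` is concentrated
on its support. That ultrafilter contains some `t ∈ F`, and below `t` this element vanishes. -/
theorem mul_sqJoin_eq_self_of_cover {d a : A} (hd : d ∈ S) (ha : a ∈ S) (hda : StarDom E d a)
    {F : List A} (hF : ∀ t ∈ F, t ∈ S)
    (hcov : ∀ U : Ultrafilters S E, a ∈ U.1 → ∃ t ∈ F, t ∈ U.1) : d * sqJoin F = d := by
  have hj := h.sqJoin_mem hF
  have hv := h.sq_mem hd
  by_contra hne
  have hp1 : star d * d - star d * d * sqJoin F ≠ 0 := fun h0 =>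
    hne (h.mul_eq_self_of_sq hj (sub_eq_zero.1 h0).symm)
  have hp := L.sub_mem hv (L.mul_mem hv hj)
  obtain ⟨k, q, hq, hqS, hq0, hqp, hfa, V, hV⟩ :=
    h.exists_ultrafilter_of_ne_zero ha hp
      (le_zero_sub_iff.2 (h.mul_sqJoin_le hF hv (le_star_mul_self d))) (by
        rw [sub_mul, mul_assoc _ (sqJoin F), h.comm _ hj _ (h.sq_mem ha), ← mul_assoc _ _ (sqJoin F),
          hda.sq_mul_sq]) hp1
  obtain ⟨t, htF, htV⟩ := hcov V (V.2.isFilter.up hV ha hfa)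
  obtain ⟨g, hg, hgt, hgf⟩ := V.2.isFilter.directed htV hV
  have hgS := V.2.isFilter.subset hg
  have hgj : star g * g * sqJoin F = star g * g :=
    h.mul_sqJoin_eq_self hF htF hgt.sq_mul_sq
  have h1 : (k • (star d * d - star d * d * sqJoin F)) * (star g * g) = 0 := by
    rw [smul_mul_assoc, h.comm _ hp _ (h.sq_mem hgS), mul_sub, h.comm _ hv _ hj, ← mul_assoc _ (sqJoin F),
      hgj, sub_self, smul_zero]
  have h2 := h.mul_eq_zero_of_le hq (L.nsmul_mem hp k) (h.sq_mem hgS) hq0 (le_star_mul_self g)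
    hqp h1
  have h3 : g * q = 0 := h.mul_eq_zero_of_sq hq (by rw [h.comm _ (h.sq_mem hgS) _ hq, h2])
  have h4 : g = 0 := by
    have h5 := hgf.2
    rw [Dom, star_mul, star_mul, h.star_eq hq] at h5
    rw [h5]
    simp only [← mul_assoc]
    simp [h3]
  exact h.zero_notMem V.2 (h4 ▸ hg)

theorem starDom_mul_sq {g a p : A} (ha : a ∈ S) (hp : p ∈ S) (hga : StarDom E g a) :
    StarDom E (g * (star p * p)) a := by
  have hpE := h.weyl.star_mul_self_mem hp
  have hc := h.weyl.star_mul_self_comm ha hpE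
  constructor
  · have e : g * (star p * p) * star a = g * star a * (a * (star p * p) * star a) := by
      conv_lhs => rw [hga.2]
      simp only [mul_assoc]
    change g * (star p * p) * star a ∈ E
    rw [e]
    exact h.weyl.mul_mem_E _ hga.1 _ (h.weyl.conj_mem ha hpE)
  · change g * (star p * p) = g * (star p * p) * (star a * a)
    rw [mul_assoc g, ← hc, ← mul_assoc g (star a * a), ← hga.2]

/-- Otherwise the products `f k * (w* w)`, with `f` a chain between `e` and `a` and `w ∈ U`,
generate an ultrafilter `V` containing `a`, hence `b`. Then `U ⊆ V`, and maximality of `U` puts `a`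
in `U`. -/
theorem exists_mul_sq_eq_zero {d e a b : A} (hd : d ∈ S) (he : e ∈ S) (ha : a ∈ S)
    (hde : StarDom E d e) (hea : StarDom E e a)
    (hab : ∀ V : Ultrafilters S E, a ∈ V.1 → b ∈ V.1) {U : Ultrafilters S E} (hbU : b ∈ U.1)
    (haU : a ∉ U.1) : ∃ w ∈ U.1, d * (star w * w) = 0 := by
  by_contra! hne
  obtain ⟨f, hfS, hfa, hfl, hfd⟩ := h.exists_chain he ha hea
  have hUS := U.2.isFilter.subset
  obtain ⟨V, hV⟩ := h.exists_ultrafilter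
    (B := {x | ∃ k : ℕ, ∃ w ∈ U.1, x = f k * (star w * w)}) (by
      rintro _ ⟨k, w, hw, rfl⟩
      exact h.weyl.mul_mem _ (hfS k) _ (h.weyl.subset (h.weyl.star_mul_self_mem (hUS hw))))
    ⟨_, 0, b, hbU, rfl⟩ (by
      rintro ⟨k, w, hw, h0⟩
      refine hne w hw ?_
      rw [(hfd k d hd hde).2, mul_assoc, mul_assoc (star (f k)), ← h0]
      simp) (by
      rintro _ ⟨k, w, hw, rfl⟩ _ ⟨l, w', hw', rfl⟩
      obtain ⟨z, hz, hzw, hzw'⟩ := U.2.isFilter.directed hw hw'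
      exact ⟨_, ⟨max k l + 1, z, hz, rfl⟩,
        h.weyl.starDom_mul (hfS k) (hfl _ _ (by omega))
          (h.weyl.starDom_star_mul_self (hUS hw) hzw),
        h.weyl.starDom_mul (hfS l) (hfl _ _ (by omega))
          (h.weyl.starDom_star_mul_self (hUS hw') hzw')⟩)
  have haV : a ∈ V.1 := V.2.isFilter.up (hV ⟨0, b, hbU, rfl⟩) ha
    (h.starDom_mul_sq ha (hUS hbU) (hfa 0))
  -- An element `g ∈ V` below `b` that absorbs `w* w` is compatible with `u` through `b` and `w`: `g
  -- u* = (g b*)(b w*)(w u*)`.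
  have hUV : U.1 ⊆ V.1 := by
    intro u hu
    obtain ⟨w, hw, hwu, hwb⟩ := U.2.isFilter.directed hu hbU
    obtain ⟨w', hw', hww⟩ := U.2.isFilter.exists_starDom hw
    obtain ⟨g, hg, hgb, hgx⟩ := V.2.isFilter.directed (hab V haV) (hV ⟨0, w', hw', rfl⟩)
    have hgw : g * (star w * w) = g := by
      have h1 := hgx.2
      have h2 : f 0 * (star w' * w') * (star w * w) = f 0 * (star w' * w') := by
        rw [mul_assoc, hww.sq_mul_sq]
      rw [Dom] at h1
      conv_lhs => rw [h1]
      rw [mul_assoc, mul_assoc, h2, ← h1]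
    refine V.2.isFilter.up hg (hUS hu) ⟨?_, ?_⟩
    · have e : g * star u = g * star b * (b * star w * (w * star u)) := by
        conv_lhs => rw [← hgw, hgb.2]
        simp only [mul_assoc]
      change g * star u ∈ E
      rw [e]
      exact h.weyl.mul_mem_E _ hgb.1 _
        (h.weyl.mul_mem_E _ (h.weyl.compat_symm hwb.1) _ hwu.1)
    · change g = g * (star u * u)
      conv_rhs => rw [← hgw, mul_assoc, hwu.sq_mul_sq, hgw]
  exact haU (U.2.maximal V.1 V.2.isFilter V.2.proper hUV ▸ haV)

end StandingAssumption

end WeylGroupoid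

/-! ### Compact containment versus domination -/

namespace WeylGroupoid

variable {A : Type*} [NonUnitalRing A] [StarRing A]

theorem CompactlyContained.exists_list {S E : Set A} {a b : A}
    (hab : CompactlyContained (basicOpen S E a) (basicOpen S E b)) {T : Set A} (hT : T ⊆ S)
    (hcov : ∀ U : Ultrafilters S E, b ∈ U.1 → ∃ t ∈ T, t ∈ U.1) :
    ∃ F : List A, (∀ t ∈ F, t ∈ T) ∧ ∀ U : Ultrafilters S E, a ∈ U.1 → ∃ t ∈ F, t ∈ U.1 := by
  obtain ⟨F, hFT, hF, hFa⟩ := Set.exists_subset_image_finite_and.1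
    (hab (basicOpen S E '' T) (by rintro _ ⟨t, ht, rfl⟩; exact isOpen_basicOpen (hT ht))
      (fun U hU => by
        obtain ⟨t, ht, htU⟩ := hcov U hU
        exact ⟨_, ⟨t, ht, rfl⟩, htU⟩))
  refine ⟨hF.toFinset.toList, by simpa using fun t ht => hFT ht, fun U hU => ?_⟩
  obtain ⟨_, ⟨t, ht, rfl⟩, htU⟩ := hFa hU
  exact ⟨t, by simpa using ht, htU⟩

section Generated

variable {E : Set A}

theorem subset_starSubringGenerated : E ⊆ starSubringGenerated E :=
  fun _ hx _ _ hE => hE hx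

theorem starSubringGenerated_add {x y : A} (hx : x ∈ starSubringGenerated E)
    (hy : y ∈ starSubringGenerated E) : x + y ∈ starSubringGenerated E :=
  fun R hR hE => R.add_mem (hx R hR hE) (hy R hR hE)

theorem starSubringGenerated_sub {x y : A} (hx : x ∈ starSubringGenerated E)
    (hy : y ∈ starSubringGenerated E) : x - y ∈ starSubringGenerated E :=
  fun R hR hE => R.sub_mem (hx R hR hE) (hy R hR hE)

theorem starSubringGenerated_mul {x y : A} (hx : x ∈ starSubringGenerated E)
    (hy : y ∈ starSubringGenerated E) : x * y ∈ starSubringGenerated E :=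
  fun R hR hE => R.mul_mem (hx R hR hE) (hy R hR hE)

theorem starSubringGenerated_zero : (0 : A) ∈ starSubringGenerated E :=
  fun R _ _ => R.zero_mem

end Generated

namespace StandingAssumption

variable {S E : Set A} {L : NonUnitalSubring A} (h : StandingAssumption S E L)

include h

theorem exists_unit_of_compactlyContained {a b : A} (ha : a ∈ S) (hb : b ∈ S)
    (hab : CompactlyContained (basicOpen S E a) (basicOpen S E b)) :
    ∃ j ∈ L, j ∈ S ∧ j * (star b * b) = j ∧ (∀ d ∈ S, StarDom E d a → d * j = d) ∧
      ∃ c ∈ S, StarDom E (b * (j * j)) c ∧ StarDom E c b := by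
  -- The intermediate `t'` provide a second join that is a unit for the join of the `t`.
  obtain ⟨F, hFT, hFa⟩ := hab.exists_list
    (T := {t | t ∈ S ∧ ∃ t' ∈ S, StarDom E t t' ∧ StarDom E t' b}) (fun t ht => ht.1) (by
      intro U hU
      obtain ⟨t', ht', hb'⟩ := U.2.isFilter.exists_starDom hU
      obtain ⟨t, ht, htt⟩ := U.2.isFilter.exists_starDom ht'
      exact ⟨t, ⟨U.2.isFilter.subset ht, t', U.2.isFilter.subset ht', htt, hb'⟩, ht⟩)
  have hFS : ∀ t ∈ F, t ∈ S := fun t ht => (hFT t ht).1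
  choose! g hg using fun t ht => (hFT t ht).2
  have hGS : ∀ t ∈ F.map g, t ∈ S := by
    simpa using fun t ht => (hg t ht).1
  have hunit : ∀ F : List A, (∀ t ∈ F, StarDom E t b) →
      sqJoin F * (star b * b) = sqJoin F := fun F hF =>
    sqJoin_mul_eq_self fun t ht => (hF t ht).sq_mul_sq
  have hmem : ∀ F : List A, (∀ t ∈ F, t ∈ S) → (∀ t ∈ F, StarDom E t b) → sqJoin F ∈ S := by
    intro F hFS hF
    refine h.mem_of_le (h.sqJoin_mem hFS) (h.sqJoin_nonneg hFS) hb ?_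
    have h1 := h.mul_sqJoin_le hFS (h.sq_mem hb) (le_star_mul_self b)
    rwa [h.comm _ (h.sq_mem hb) _ (h.sqJoin_mem hFS), hunit F hF] at h1
  have hFb : ∀ t ∈ F, StarDom E t b := fun t ht =>
    h.weyl.starDom_trans (hg t ht).2.1 (hg t ht).2.2
  have hGb : ∀ t ∈ F.map g, StarDom E t b := by
    simpa using fun t ht => (hg t ht).2.2
  have hjL := h.sqJoin_mem hFS
  have hjS := hmem F hFS hFb
  have hjL' := h.sqJoin_mem hGS
  have hjS' := hmem _ hGS hGb
  have hjj : sqJoin F * sqJoin (F.map g) = sqJoin F := sqJoin_mul_eq_self fun t ht =>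
    h.mul_sqJoin_eq_self hGS (List.mem_map_of_mem ht) (hg t ht).2.1.sq_mul_sq
  refine ⟨sqJoin F, hjL, hjS, hunit F hFb,
    fun d hd hda => h.mul_sqJoin_eq_self_of_cover hd ha hda hFS hFa,
    b * (sqJoin (F.map g) * sqJoin (F.map g)),
    h.weyl.mul_mem _ hb _ (h.weyl.mul_mem _ hjS' _ hjS'), ?_, ?_⟩
  · refine h.starDom_mul_right hb (h.weyl.compat_refl hb) (L.mul_mem hjL hjL)
      (L.mul_mem hjL' hjL') (h.mul_self_mem_E hjL hjS) ?_ ?_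
    · rw [mul_assoc, ← mul_assoc (sqJoin F) (sqJoin (F.map g)), hjj, ← mul_assoc, mul_assoc, hjj]
    · rw [mul_assoc, hunit F hFb]
  · refine h.starDom_mul_left hb (h.weyl.compat_refl hb) (L.mul_mem hjL' hjL')
      (h.mul_self_mem_E hjL' hjS') ?_
    rw [mul_assoc, hunit _ hGb]

theorem exists_lower_subset_of_compat {a b : A} (ha : a ∈ S) (hb : b ∈ S)
    (hcompat : Compat E a b)
    (hab : CompactlyContained (basicOpen S E a) (basicOpen S E b)) :
    ∃ c ∈ S, lower S E {a} ⊆ lower S E {c} ∧ StarDom E c b := by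
  obtain ⟨j, hj, hjS, hjb, hdj, c, -, hjc, hcb⟩ :=
    h.exists_unit_of_compactlyContained ha hb hab
  refine ⟨b * (j * j), h.weyl.mul_mem _ hb _ (h.weyl.mul_mem _ hjS _ hjS), ?_,
    h.weyl.starDom_trans hjc hcb⟩
  rintro d ⟨hd, a', haa', hda⟩
  rw [Set.mem_singleton_iff.1 haa'] at hda
  have hdj' := hdj d hd hda
  refine ⟨hd, _, rfl, h.starDom_of_mul_eq hb ⟨?_, ?_⟩ (L.mul_mem hj hj)
    (h.mul_self_mem_E hj hjS) (by rw [← mul_assoc, hdj', hdj'])⟩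
  · have e : d * star b = d * star a * (a * star b) := by
      conv_lhs => rw [hda.2]
      simp only [mul_assoc]
    change d * star b ∈ E
    rw [e]
    exact h.weyl.mul_mem_E _ hda.1 _ hcompat
  · change d = d * (star b * b)
    conv_rhs => rw [← hdj', mul_assoc, hjb, hdj']

theorem conj_sqJoin_mul_mem {b : A} (hb : b ∈ S) {F : List A} (hF : ∀ t ∈ F, t ∈ S) {X : A}
    (hX : X ∈ E) : b * (sqJoin F * X) * star b ∈ starSubringGenerated E := by
  induction F generalizing X with
  | nil => simpa [sqJoin] using starSubringGenerated_zero
  | cons t F ih =>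
    rw [List.forall_mem_cons] at hF
    have htX := h.weyl.mul_mem_E _ (h.weyl.star_mul_self_mem hF.1) _ hX
    have e : b * (sqJoin (t :: F) * X) * star b
        = b * (star t * t * X) * star b + b * (sqJoin F * X) * star b
          - b * (sqJoin F * (star t * t * X)) * star b := by
      rw [sqJoin]
      simp only [mul_sub, sub_mul, mul_add, add_mul, mul_assoc]
    rw [e]
    exact starSubringGenerated_sub (starSubringGenerated_add
      (subset_starSubringGenerated (h.weyl.conj_mem hb htX)) (ih hF.2 hX)) (ih hF.2 htX)

/-- Expanding the join, each term factors through `(d t*)(t b*)(b y b*)`. Here `d t*` is zero, or in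
`E` because `d` and `t` both lie below `a`. -/
theorem mul_sqJoin_mul_mem {a b d X : A} (hb : b ∈ S) (hda : StarDom E d a) (hX : X ∈ E)
    (hXL : X ∈ L) (hXb : X * (star b * b) = X) {F : List A}
    (hF : ∀ t ∈ F, t ∈ S ∧ StarDom E t b ∧ (d * star t = 0 ∨ StarDom E t a)) :
    d * (sqJoin F * X) * star b ∈ starSubringGenerated E := by
  have key : ∀ t, StarDom E t b → (d * star t = 0 ∨ StarDom E t a) → ∀ y ∈ L,
      y * (star b * b) = y → b * y * star b ∈ starSubringGenerated E →
      d * (star t * t * y) * star b ∈ starSubringGenerated E := by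
    intro t htb ht y hy hyb hyR
    have hby : star b * b * y = y := by rw [h.comm _ (h.sq_mem hb) _ hy, hyb]
    have e : d * (star t * t * y) * star b = d * star t * (t * star b * (b * y * star b)) := by
      conv_lhs => rw [← hby]
      simp only [mul_assoc]
    rw [e]
    rcases ht with ht | ht
    · rw [ht, zero_mul]
      exact starSubringGenerated_zero
    · have e' : d * star t = d * star a * (a * star t) := by
        conv_lhs => rw [hda.2]
        simp only [mul_assoc]
      have hdt : d * star t ∈ E := by
        rw [e']
        exact h.weyl.mul_mem_E _ hda.1 _ (h.weyl.compat_symm ht.1)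
      exact starSubringGenerated_mul (subset_starSubringGenerated hdt)
        (starSubringGenerated_mul (subset_starSubringGenerated htb.1) hyR)
  induction F with
  | nil => simpa [sqJoin] using starSubringGenerated_zero
  | cons t F ih =>
    rw [List.forall_mem_cons] at hF
    have hFS : ∀ t ∈ F, t ∈ S := fun t ht => (hF.2 t ht).1
    have hj := h.sqJoin_mem hFS
    have e : d * (sqJoin (t :: F) * X) * star b
        = d * (star t * t * X) * star b + d * (sqJoin F * X) * star b
          - d * (star t * t * (sqJoin F * X)) * star b := by
      rw [sqJoin, h.comm _ hj _ (h.sq_mem hF.1.1)]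
      simp only [mul_sub, sub_mul, mul_add, add_mul, mul_assoc]
    rw [e]
    exact starSubringGenerated_sub (starSubringGenerated_add
      (key t hF.1.2.1 hF.1.2.2 X hXL hXb (subset_starSubringGenerated (h.weyl.conj_mem hb hX)))
      (ih hF.2)) (key t hF.1.2.1 hF.1.2.2 _ (L.mul_mem hj hXL) (by rw [mul_assoc, hXb])
        (h.conj_sqJoin_mul_mem hb hFS hX))

theorem exists_lower_lower_subset_of_unitBall {a b : A} (ha : a ∈ S) (hb : b ∈ S)
    (hE : E = starSubringGenerated E ∩ unitBall A)
    (hab : CompactlyContained (basicOpen S E a) (basicOpen S E b)) :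
    ∃ c ∈ S, lower S E (lower S E {a}) ⊆ lower S E (lower S E {c}) ∧ StarDom E c b := by
  obtain ⟨j, hj, hjS, hjb, hdj, c, hc, hjc, hcb⟩ :=
    h.exists_unit_of_compactlyContained ha hb hab
  have hjjS := h.weyl.mul_mem _ hb _ (h.weyl.mul_mem _ hjS _ hjS)
  have hsub := hab.subset (isOpen_basicOpen hb)
  refine ⟨c, hc, ?_, hcb⟩
  rintro d ⟨hd, e, ⟨he, a', haa', hea⟩, hde⟩
  rw [Set.mem_singleton_iff.1 haa'] at hea
  refine ⟨hd, b * (j * j), ⟨hjjS, _, rfl, hjc⟩, ?_⟩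
  have hda := h.weyl.starDom_trans hde hea
  have hdj' := hdj d hd hda
  have hdb : d * (star b * b) = d := by
    conv_lhs => rw [← hdj', mul_assoc, hjb, hdj']
  -- Ultrafilters in `𝓤_b` containing `a` have members below both `a` and `b`; the others have
  -- members `t ≾ b` with `d t* = 0`.
  obtain ⟨F, hFT, hFa⟩ := hab.exists_list
    (T := {t | t ∈ S ∧ StarDom E t b ∧ (d * star t = 0 ∨ StarDom E t a)}) (fun t ht => ht.1) (by
      intro U hU
      by_cases haU : a ∈ U.1
      · obtain ⟨t, ht, hta, htb⟩ := U.2.isFilter.directed haU hU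
        exact ⟨t, ⟨U.2.isFilter.subset ht, htb, Or.inr hta⟩, ht⟩
      · obtain ⟨w, hw, hdw⟩ := h.exists_mul_sq_eq_zero hd he ha hde hea
          (fun V hV => hsub hV) hU haU
        obtain ⟨t, ht, htw, htb⟩ := U.2.isFilter.directed hw hU
        refine ⟨t, ⟨U.2.isFilter.subset ht, htb, Or.inl ?_⟩, ht⟩
        rw [htw.2, star_mul, star_mul, star_star, ← mul_assoc, hdw, zero_mul])
  have hdF := h.mul_sqJoin_eq_self_of_cover hd ha hda (fun t ht => (hFT t ht).1) hFa
  have hR := h.mul_sqJoin_mul_mem hb hda (h.mul_self_mem_E hj hjS) (L.mul_mem hj hj)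
    (by rw [mul_assoc, hjb]) hFT
  rw [← mul_assoc, hdF, ← h.star_eq (L.mul_mem hj hj), mul_assoc, ← star_mul] at hR
  constructor
  · change d * star (b * (j * j)) ∈ E
    rw [hE]
    exact ⟨hR, h.subset_unitBall (h.weyl.mul_mem _ hd _ (h.weyl.star_mem _ hjjS))⟩
  · change d = d * (star (b * (j * j)) * (b * (j * j)))
    have hdjj : d * (j * j) = d := by rw [← mul_assoc, hdj', hdj']
    symm
    calc d * (star (b * (j * j)) * (b * (j * j)))
        = d * (j * j) * (star b * b) * (j * j) := by
          rw [star_mul, h.star_eq (L.mul_mem hj hj)]; simp only [mul_assoc]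
      _ = d := by rw [hdjj, hdb, hdjj]

/-- The elements `f k * y²`, where `y` is `(f k)* (f k)` with a finite join of cover elements
removed, generate an ultrafilter containing `b` that contains none of the cover elements in `T`. -/
theorem compactlyContained_of_lower_lower_subset {a b c : A} (hb : b ∈ S)
    (hc : c ∈ S) (hac : lower S E (lower S E {a}) ⊆ lower S E {c}) (hcb : StarDom E c b) :
    CompactlyContained (basicOpen S E a) (basicOpen S E b) := by
  intro C hCo hC
  by_contra! hno
  -- The element `e` between `s` and `t` leaves room to enlarge `s` inside `T`, as directedness
  -- requires below.
  let T : Set A := {s | s ∈ S ∧ ∃ e ∈ S, ∃ t ∈ S, StarDom E s e ∧ StarDom E e t ∧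
    StarDom E t b ∧ ∃ W ∈ C, basicOpen S E t ⊆ W}
  have hTS : ∀ F : List A, (∀ s ∈ F, s ∈ T) → ∀ s ∈ F, s ∈ S := fun F hF s hs => (hF s hs).1
  obtain ⟨f, hfS, hfb, hfl, hfd⟩ := h.exists_chain hc hb hcb
  have hlow : ∀ w ∈ S, ∀ e ∈ S, StarDom E w e → StarDom E e a → StarDom E w c := by
    intro w hw e he hwe hea
    obtain ⟨-, _, rfl, hwc⟩ := hac ⟨hw, e, ⟨he, a, rfl, hea⟩, hwe⟩
    exact hwc
  have hsub : ∀ V : Ultrafilters S E, a ∈ V.1 → b ∈ V.1 := by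
    intro V haV
    obtain ⟨e, he, hea⟩ := V.2.isFilter.exists_starDom haV
    obtain ⟨w, hw, hwe⟩ := V.2.isFilter.exists_starDom he
    have hS := V.2.isFilter.subset
    exact V.2.isFilter.up hw hb
      (h.weyl.starDom_trans (hlow w (hS hw) e (hS he) hwe hea) hcb)
  -- A point of `𝓤_a` outside the finitely many chosen cover sets contains annihilators of each `s ∈
  -- F`; a common lower bound of them is the nonzero `w`.
  have hfin : ∀ F : List A, (∀ s ∈ F, s ∈ T) →
      ∃ w ∈ S, w ≠ 0 ∧ StarDom E w c ∧ ∀ s ∈ F, w * (star s * s) = 0 := by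
    intro F hF
    choose! e he t ht hse het htb W hWC hW using fun s hs => (hF s hs).2
    obtain ⟨V, haV, hVW⟩ := Set.not_subset.1 (hno (W '' {s | s ∈ F})
      (by rintro _ ⟨s, hs, rfl⟩; exact hWC s hs) ((List.finite_toSet F).image W))
    have hS := V.2.isFilter.subset
    obtain ⟨e', he', hea'⟩ := V.2.isFilter.exists_starDom haV
    have hall : ∀ G : List A, (∀ s ∈ G, s ∈ F) →
        ∃ w ∈ V.1, StarDom E w e' ∧ ∀ s ∈ G, w * (star s * s) = 0 := by
      intro G
      induction G with
      | nil =>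
        obtain ⟨w, hw, hwe⟩ := V.2.isFilter.exists_starDom he'
        exact fun _ => ⟨w, hw, hwe, by simp⟩
      | cons s G ih =>
        intro hG
        rw [List.forall_mem_cons] at hG
        obtain ⟨w, hw, hwe, hwG⟩ := ih hG.2
        have hsF := hG.1
        obtain ⟨w', hw', hsw⟩ := h.exists_mul_sq_eq_zero (hF s hsF).1 (he s hsF) (ht s hsF)
          (hse s hsF) (het s hsF) (fun U hU => U.2.isFilter.up hU hb (htb s hsF))
          (hsub V haV) (fun htV => hVW ⟨_, ⟨s, hsF, rfl⟩, hW s hsF htV⟩)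
        obtain ⟨z, hz, hzw, hzw'⟩ := V.2.isFilter.directed hw hw'
        refine ⟨z, hz, h.weyl.starDom_trans hzw hwe, ?_⟩
        rw [List.forall_mem_cons]
        constructor
        · have h1 : star w' * w' * star s = 0 := by
            have := congrArg star hsw
            simpa [mul_assoc] using this
          rw [hzw'.2, ← mul_assoc, mul_assoc z, h1]
          simp
        · intro r hr
          have h2 := hwG r hr
          rw [hzw.2, mul_assoc, mul_assoc (star w), h2]
          simp
    obtain ⟨w, hw, hwe, hwF⟩ := hall F fun _ hs => hs
    exact ⟨w, hS hw, fun h0 => h.zero_notMem V.2 (h0 ▸ hw),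
      hlow w (hS hw) e' (hS he') hwe hea', hwF⟩
  have hup : ∀ s ∈ T, ∃ s' ∈ T, StarDom E s s' := by
    rintro s ⟨hs, e, he, t, ht, hse, het, htb, hW⟩
    obtain ⟨e', he', f', hf', hef, hft, hd⟩ := h.exists_starDom_between he ht het
    exact ⟨e', ⟨he', f', hf', t, ht, hef, hft, htb, hW⟩, hd s hs hse⟩
  choose! g hgT hg using hup
  let y : ℕ → List A → A := fun k F => star (f k) * f k - star (f k) * f k * sqJoin F
  have hyL : ∀ k F, (∀ s ∈ F, s ∈ T) → y k F ∈ L := fun k F hF =>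
    L.sub_mem (h.sq_mem (hfS k)) (L.mul_mem (h.sq_mem (hfS k)) (h.sqJoin_mem (hTS F hF)))
  have hyS : ∀ k F, (∀ s ∈ F, s ∈ T) → y k F ∈ S := by
    intro k F hF
    have hu := h.sq_mem (hfS k)
    refine h.mem_of_le (hyL k F hF)
      (le_zero_sub_iff.2 (h.mul_sqJoin_le (hTS F hF) hu (le_star_mul_self _))) (hfS k) ?_
    rw [← le_zero_sub_iff, sub_sub_cancel]
    exact h.mul_nonneg hu (h.sqJoin_mem (hTS F hF)) (le_star_mul_self _)
      (h.sqJoin_nonneg (hTS F hF))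
  have hyr : ∀ k F x, (∀ s ∈ F, s ∈ T) → x ∈ L → star (f k) * f k * x = star (f k) * f k →
      y k F * x = y k F := by
    intro k F x hF hx hux
    simp only [y]
    rw [sub_mul, mul_assoc _ (sqJoin F), h.comm _ (h.sqJoin_mem (hTS F hF)) _ hx,
      ← mul_assoc _ x, hux]
  obtain ⟨V, hV⟩ := h.exists_ultrafilter
    (B := {x | ∃ k F, (∀ s ∈ F, s ∈ T) ∧ x = f k * (y k F * y k F)}) (by
      rintro _ ⟨k, F, hF, rfl⟩
      exact h.weyl.mul_mem _ (hfS k) _ (h.weyl.mul_mem _ (hyS k F hF) _ (hyS k F hF)))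
    ⟨_, 0, [], by simp, rfl⟩ (by
      rintro ⟨k, F, hF, h0⟩
      obtain ⟨w, hw, hw0, hwc, hwF⟩ := hfin F hF
      have hwf := (hfd k w hw hwc).2
      have hwy : w * y k F = w := by
        simp only [y]
        rw [mul_sub, ← mul_assoc w _ (sqJoin F), ← hwf, mul_sqJoin_eq_zero hwF, sub_zero]
      refine hw0 ?_
      calc w = w * y k F * y k F := by rw [hwy, hwy]
        _ = w * (star (f k) * f k) * (y k F * y k F) := by rw [← hwf, mul_assoc]
        _ = w * star (f k) * (f k * (y k F * y k F)) := by simp only [mul_assoc]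
        _ = 0 := by rw [← h0, mul_zero]) (by
      have hle : ∀ k l F G, k < l → (∀ s ∈ F, s ∈ T) → (∀ s ∈ G, s ∈ T) →
          (∀ s ∈ F, g s ∈ G) →
          StarDom E (f l * (y l G * y l G)) (f k * (y k F * y k F)) := by
        intro k l F G hkl hF hG hFG
        have hlk := hfl k l hkl
        have hyy : y l G * y k F = y l G := by
          have hu : y l G * (star (f k) * f k) = y l G :=
            hyr l G _ hG (h.sq_mem (hfS k)) hlk.sq_mul_sq
          -- `G` contains some `g s` above each `s ∈ F`, so its join is a unit for that of `F`, and
          -- the complement of the larger join is absorbed by the complement of the smaller.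
          have hjj : sqJoin G * sqJoin F = sqJoin F := by
            rw [h.comm _ (h.sqJoin_mem (hTS G hG)) _ (h.sqJoin_mem (hTS F hF))]
            exact sqJoin_mul_eq_self fun s hs =>
              h.mul_sqJoin_eq_self (hTS G hG) (hFG s hs) (hg s (hF s hs)).sq_mul_sq
          have hz : y l G * sqJoin F = 0 := by
            simp only [y]
            rw [sub_mul, mul_assoc _ (sqJoin G), hjj, sub_self]
          calc y l G * y k F
              = y l G * (star (f k) * f k) - y l G * (star (f k) * f k) * sqJoin F := by
                rw [mul_assoc _ _ (sqJoin F), ← mul_sub]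
            _ = y l G := by rw [hu, hz, sub_zero]
        have hyG := hyL l G hG
        have hyF := hyL k F hF
        refine h.starDom_mul_right (hfS k) hlk.1 (L.mul_mem hyG hyG) (L.mul_mem hyF hyF)
          (h.mul_self_mem_E hyG (hyS l G hG)) ?_ ?_
        · rw [mul_assoc, ← mul_assoc (y l G) (y k F), hyy, ← mul_assoc, mul_assoc, hyy]
        · rw [mul_assoc, hyr l G _ hG (h.sq_mem (hfS k)) hlk.sq_mul_sq]
      rintro _ ⟨k, F, hF, rfl⟩ _ ⟨l, G, hG, rfl⟩
      have hFG : ∀ s ∈ (F ++ G).map g, s ∈ T := by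
        intro s hs
        obtain ⟨r, hr, rfl⟩ := List.mem_map.1 hs
        rcases List.mem_append.1 hr with hr | hr
        · exact hgT r (hF r hr)
        · exact hgT r (hG r hr)
      exact ⟨_, ⟨max k l + 1, (F ++ G).map g, hFG, rfl⟩,
        hle _ _ _ _ (by omega) hF hFG fun s hs =>
          List.mem_map_of_mem (List.mem_append_left _ hs),
        hle _ _ _ _ (by omega) hG hFG fun s hs =>
          List.mem_map_of_mem (List.mem_append_right _ hs)⟩)
  have hS := V.2.isFilter.subset
  have hbV : b ∈ V.1 := by
    have hyN : y 0 [] ∈ L := hyL 0 [] (by simp)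
    refine V.2.isFilter.up (hV ⟨0, [], by simp, rfl⟩) hb
      (h.starDom_mul_left hb (hfb 0).1 (L.mul_mem hyN hyN)
        (h.mul_self_mem_E hyN (hyS 0 [] (by simp))) ?_)
    rw [mul_assoc, hyr 0 [] _ (by simp) (h.sq_mem hb) (hfb 0).sq_mul_sq]
  obtain ⟨W, hWC, hVW⟩ := hC hbV
  obtain ⟨t', ht', htW⟩ := exists_mem_basicOpen_subset (hCo W hWC) hVW
  obtain ⟨t, ht, htt, htb⟩ := V.2.isFilter.directed ht' hbV
  obtain ⟨e, he, het⟩ := V.2.isFilter.exists_starDom ht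
  obtain ⟨s, hs, hse⟩ := V.2.isFilter.exists_starDom he
  -- Since the cover reaches `V`, some `s ∈ T` lies in `V` together with an element from which `s`
  -- was removed; a common lower bound must be `0`.
  have hsT : s ∈ T := ⟨hS hs, e, hS he, t, hS ht, hse, het, htb, W, hWC, fun U hU =>
    htW (U.2.isFilter.up hU (hS ht') htt)⟩
  have hsT' : ∀ r ∈ [s], r ∈ T := by simpa using hsT
  obtain ⟨z, hz, hzs, hzy⟩ := V.2.isFilter.directed hs (hV ⟨0, [s], hsT', rfl⟩)
  have hzj : z * sqJoin [s] = z :=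
    h.mul_sqJoin_eq_self (hTS _ hsT') (List.mem_singleton_self s) hzs.2.symm
  have hzy0 : z * y 0 [s] = 0 := by
    simp only [y]
    rw [h.comm _ (h.sq_mem (hfS 0)) _ (h.sqJoin_mem (hTS _ hsT')), mul_sub,
      ← mul_assoc z (sqJoin [s]), hzj, sub_self]
  have hz0 : z = 0 := by
    have h5 := hzy.2
    rw [Dom, star_mul, star_mul, h.star_eq (hyL 0 [s] hsT')] at h5
    rw [h5]
    simp only [← mul_assoc]
    simp [hzy0]
  exact h.zero_notMem V.2 (hz0 ▸ hz)

end StandingAssumption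

end WeylGroupoid

theorem theorem3p30 {A : Type*} [NonUnitalRing A] [StarRing A]
    (S E : Set A) (L : NonUnitalSubring A)
    (h : WeylGroupoid.StandingAssumption S E L)
    (a b : A) (ha : a ∈ S) (hb : b ∈ S) :
    ((∃ c ∈ S,
        WeylGroupoid.lower S E (WeylGroupoid.lower S E {a}) ⊆ WeylGroupoid.lower S E {c} ∧
        WeylGroupoid.StarDom E c b) →
      WeylGroupoid.CompactlyContained
        (WeylGroupoid.basicOpen S E a) (WeylGroupoid.basicOpen S E b)) ∧
    (E = WeylGroupoid.starSubringGenerated E ∩ WeylGroupoid.unitBall A →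
      WeylGroupoid.CompactlyContained
        (WeylGroupoid.basicOpen S E a) (WeylGroupoid.basicOpen S E b) →
      ∃ c ∈ S,
        WeylGroupoid.lower S E (WeylGroupoid.lower S E {a}) ⊆
          WeylGroupoid.lower S E (WeylGroupoid.lower S E {c}) ∧
        WeylGroupoid.StarDom E c b) ∧
    (a ∈ WeylGroupoid.lower S E S → b ∈ WeylGroupoid.lower S E S →
      WeylGroupoid.Compat E a b →
      WeylGroupoid.CompactlyContained
        (WeylGroupoid.basicOpen S E a) (WeylGroupoid.basicOpen S E b) →
      ∃ c ∈ S,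
        WeylGroupoid.lower S E {a} ⊆ WeylGroupoid.lower S E {c} ∧
        WeylGroupoid.StarDom E c b) :=
  ⟨fun ⟨_, hc, hac, hcb⟩ => h.compactlyContained_of_lower_lower_subset hb hc hac hcb,
    h.exists_lower_lower_subset_of_unitBall ha hb,
    fun _ _ hcompat => h.exists_lower_subset_of_compat ha hb hcompat⟩
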